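/- For an integer $n\ge 0$ let $G_n$ be the TSSCPP graph of size $n$. Its vertex set is $$V_n=\{(x_1,x_2)\in\mathbb Z^2: 0\le x_1\le 2n,\ x_1\le x_2\le 2n+1\},$$ with the point $(2n,2n+1)$ removed when $n$ is odd, and its edges are * $\{(x_1,x_2),(x_1+1,x_2)\}$ for $0\le x_1\le 2n-1$, $x_1\le x_2\le 2n+1$, $x_1+x_2$ odd; * $\{(x_1,x_2),(x_1,x_2+1)\}$ for $0\le x_1\le 2n$ if $n$ is even, $0\le x_1\le 2n-1$ if $n$ is odd, and $x_1\le x_2\le 2n$; * $\{(x_1,x_1),(x_1+1,x_1+1)\}$ for $0\le x_1\le 2n-1$. For $U\subseteq V_n$ let $Z_n^{U}$ be the number of perfect matchings (dimer configurations) of the subgraph of $G_n$ induced on $V_n\setminus U$, and let $Z_n=Z_n^{\varnothing}$, which is positive. Let $\mathbf b=\mathbf b_n$ denote the vertex $(2n,2n+1)$ if $n$ is even and $(2n,2n)$ if $n$ is odd. Put $$g_n^{\mathbf b}(j)=\frac{Z_n^{\{(j,j),\mathbf b\}}}{Z_n}\quad(0\le j\le 2n-1),\qquad g_n(i,j)=\frac{Z_n^{\{(i,i),(j,j)\}}}{Z_n}\quad(0\le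 i<j\le 2n-1).$$ For all integers $n,i,j$ with $n\ge 1$ and $0\le i<j\le 2n-1$, $$g_n(i,j)=\begin{cases} 1-g_n^{\mathbf b}(j) & \text{if } i=0,\\[2pt] \dfrac{Z_{n-1}}{Z_n}\,g_{n-1}^{\mathbf b}(j-2) & \text{if } i=1,\\[6pt] g_{n-1}(i-2,j-2)-g_n^{\mathbf b}(j)\,g_{n-1}^{\mathbf b}(i-2)+g_n^{\mathbf b}(i)\,g_{n-1}^{\mathbf b}(j-2) & \text{if } i\ge 2. \end{cases}$$ -/

import Mathlib

/-- The number of dimer configurations (perfect matchings) of a graph. -/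
noncomputable def dimerCount {V : Type*} (G : SimpleGraph V) : ℕ :=
  Nat.card {M : G.Subgraph // M.IsPerfectMatching}

namespace TSSCPP

/-- The vertex set `V_n`: all `(x₁, x₂)` with `0 ≤ x₁ ≤ 2n` and `x₁ ≤ x₂ ≤ 2n + 1`,
except that `(2n, 2n + 1)` is left out when `n` is odd. -/
def vertices (n : ℕ) : Set (ℕ × ℕ) :=
  {x | x.1 ≤ 2 * n ∧ x.1 ≤ x.2 ∧ x.2 ≤ 2 * n + 1 ∧ ¬(Odd n ∧ x = (2 * n, 2 * n + 1))}

/-- `edge n x y`: the edge from `x` to `y` is in the edge list `E_n`. The three kinds are the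
horizontal edges (starting at a point of odd coordinate sum), the vertical edges (the column
`x₁ = 2n` being left out when `n` is odd), and the edges along the diagonal. -/
def edge (n : ℕ) (x y : ℕ × ℕ) : Prop :=
  (x.1 < 2 * n ∧ x.1 ≤ x.2 ∧ x.2 ≤ 2 * n + 1 ∧ (x.1 + x.2) % 2 = 1 ∧ y = (x.1 + 1, x.2)) ∨
  (x.1 + n % 2 ≤ 2 * n ∧ x.1 ≤ x.2 ∧ x.2 ≤ 2 * n ∧ y = (x.1, x.2 + 1)) ∨
  (x.1 < 2 * n ∧ x.2 = x.1 ∧ y = (x.1 + 1, x.1 + 1))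

/-- The graph with edge set `E_n`, as a graph on all of `ℕ × ℕ`; only its restrictions to
subsets of `V_n` are used. -/
def graph (n : ℕ) : SimpleGraph (ℕ × ℕ) := SimpleGraph.fromRel (edge n)

/-- `Z_n^U`: the number of dimer configurations of the graph induced on `V_n \ U`. -/
noncomputable def ZDel (n : ℕ) (U : Set (ℕ × ℕ)) : ℕ :=
  dimerCount ((graph n).induce (vertices n \ U))

/-- `Z_n`: the number of dimer configurations of the graph `G_n` of size `n`. -/
noncomputable def Z (n : ℕ) : ℕ := ZDel n ∅

/-- The vertex `𝐛 = (2n, 2n + 1 - (n mod 2))`. -/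
def b (n : ℕ) : ℕ × ℕ := (2 * n, 2 * n + 1 - n % 2)

/-- `g_n^𝐛(j) = Z_n^{(j,j), 𝐛} / Z_n`. -/
noncomputable def gb (n j : ℕ) : ℚ := (ZDel n {(j, j), b n} : ℚ) / (Z n : ℚ)

/-- `g_n(i, j) = Z_n^{(i,i), (j,j)} / Z_n` for `i < j`, extended antisymmetrically. -/
noncomputable def g (n i j : ℕ) : ℚ :=
  if i < j then (ZDel n {(i, i), (j, j)} : ℚ) / (Z n : ℚ)
  else if j < i then -((ZDel n {(j, j), (i, i)} : ℚ) / (Z n : ℚ))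
  else 0

end TSSCPP

/-!
Everything is read off from a formula for dimer counts in an exterior algebra. The diagonal
vertices, together with `(2n, 2n + 1)`, form a path on the boundary of the triangle. Off this path
the graph is a piece of the hexagonal lattice, whose dimer configurations are families of
nonintersecting lattice paths: `n` paths start on the upper side and end on the boundary path, each
step keeping the position or raising it by one. The path vertices that they do not reach are
matched along the path. If `e x` are the basis vectors indexed by path vertices, `p k` is the
generating vector of the paths from the `k`-th source, and `ω = ∑ x, e x ∧ e (x + 1)`, then the
number of dimer configurations avoiding the path vertices in `U` is, up to a sign, the top
coefficient of `e U ∧ p 0 ∧ … ∧ p (n - 1) ∧ exp ω` (`matchCount_region`). This is proved by matching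
the layers `x₂ - x₁ = const` one after the other; each choice corresponds to expanding a factor.

The top coefficient of a contraction vanishes. Contracting with a covector `ξ` that annihilates all
`p k` therefore gives linear relations (`dimerForm_dominoVec`, `dimerForm_dominoVec₃`). They yield
* for `ξ = ((-1) ^ x)`: `Z^{0, j} + Z^{j, b} = Z`, the case `i = 0` (`pathCount_alternating`);
* for `ξ` given by the form itself: Wick's rule `dimerForm_wick`, whence the condensation identity
  `Z Z^{1, i, j, b} = Z^{1, b} Z^{i, j} - Z^{i, b} Z^{1, j} + Z^{j, b} Z^{1, i}` (`pathCount_wick`).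

Finally, removing the path vertex `1` freezes the first two columns and leaves the graph of size
`n - 1`, the vertex `b` being removed from exactly one of the two graphs (`pathCount_succ`,
`pathCount_succ_last`). This is the case `i = 1`, turns the condensation identity into the case
`i ≥ 2`, and shows inductively that `Z` is positive.
-/

open CliffordAlgebra (contractLeft contractLeft_ι_mul contractLeft_one)
open ExteriorAlgebra (ι)

namespace TSSCPP

/-! ### Perfect matchings as involutions -/

section Matchings

variable {α : Type*}

/-- Perfect matchings of the subgraph of `G` induced on `W`, encoded as involutions of the ambient
type that send every vertex of `W` to its partner and fix everything outside `W`. Deleting vertices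
then changes the set `W` but not the type. -/
def matchingInvolutions (G : SimpleGraph α) (W : Set α) : Set (α → α) :=
  {f | (∀ x ∈ W, f x ∈ W ∧ G.Adj x (f x) ∧ f (f x) = x) ∧ ∀ x ∉ W, f x = x}

/-- The number of perfect matchings of the subgraph of `G` induced on `W`. -/
noncomputable def matchCount (G : SimpleGraph α) (W : Set α) : ℕ :=
  (matchingInvolutions G W).ncard

theorem dimerCount_induce (G : SimpleGraph α) (W : Set α) :
    dimerCount (G.induce W) = matchCount G W := by
  classical
  unfold dimerCount matchCount
  rw [← Nat.card_coe_set_eq]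
  symm
  let M (f : matchingInvolutions G W) : (G.induce W).Subgraph :=
    { verts := Set.univ
      Adj := fun x y => f.1 x = y
      adj_sub := by
        intro x y h
        have := (f.2.1 x x.2).2.1
        rw [h] at this
        exact this
      edge_vert := fun _ => trivial
      symm := ⟨by
        intro x y h
        have := (f.2.1 x x.2).2.2
        rw [h] at this
        exact this⟩ }
  have hM : ∀ f, (M f).IsPerfectMatching := by
    intro f
    rw [SimpleGraph.Subgraph.isPerfectMatching_iff]
    intro v
    exact ⟨⟨f.1 v, (f.2.1 v v.2).1⟩, rfl, fun y hy => Subtype.ext (Eq.symm hy)⟩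
  refine Nat.card_congr (Equiv.ofBijective (fun f => ⟨M f, hM f⟩) ⟨?_, ?_⟩)
  · intro f f' h
    have h1 : M f = M f' := congrArg Subtype.val h
    apply Subtype.ext
    funext x
    by_cases hx : x ∈ W
    · have : (M f).Adj ⟨x, hx⟩ ⟨f.1 x, (f.2.1 x hx).1⟩ := rfl
      rw [h1] at this
      exact Eq.symm this
    · rw [f.2.2 x hx, f'.2.2 x hx]
  · rintro ⟨S, hS⟩
    have hS' := hS
    rw [SimpleGraph.Subgraph.isPerfectMatching_iff] at hS'
    choose g hg hu using hS'
    let f : α → α := fun x => if h : x ∈ W then (g ⟨x, h⟩ : α) else x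
    have hf : ∀ x : W, f x = g x := fun x => by simp [f]
    refine ⟨⟨f, ?_, ?_⟩, ?_⟩
    · intro x hx
      have h1 := hf ⟨x, hx⟩
      simp only at h1
      refine ⟨h1 ▸ (g ⟨x, hx⟩).2, ?_, ?_⟩
      · rw [h1]
        exact S.adj_sub (hg ⟨x, hx⟩)
      · rw [h1, hf]
        have := hu (g ⟨x, hx⟩) ⟨x, hx⟩ (hg ⟨x, hx⟩).symm
        rw [← this]
    · intro x hx
      simp [f, hx]
    · apply Subtype.ext
      apply SimpleGraph.Subgraph.ext
      · exact (Set.eq_univ_of_forall hS.2).symm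
      · funext x y
        apply propext
        change f x = y ↔ _
        rw [hf]
        constructor
        · intro h
          have : g x = y := Subtype.ext h
          rw [← this]
          exact hg x
        · intro h
          rw [hu x y h]

theorem matchCount_congr {G G' : SimpleGraph α} {W : Set α}
    (h : ∀ x ∈ W, ∀ y ∈ W, G.Adj x y ↔ G'.Adj x y) : matchCount G W = matchCount G' W := by
  unfold matchCount
  congr 1
  ext f
  constructor
  · rintro ⟨h1, h2⟩
    exact ⟨fun x hx => ⟨(h1 x hx).1, (h x hx _ (h1 x hx).1).1 (h1 x hx).2.1, (h1 x hx).2.2⟩, h2⟩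
  · rintro ⟨h1, h2⟩
    exact ⟨fun x hx => ⟨(h1 x hx).1, (h x hx _ (h1 x hx).1).2 (h1 x hx).2.1, (h1 x hx).2.2⟩, h2⟩

theorem matchCount_empty (G : SimpleGraph α) : matchCount G ∅ = 1 := by
  unfold matchCount
  rw [Set.ncard_eq_one]
  refine ⟨id, ?_⟩
  ext f
  simp [matchingInvolutions, funext_iff]

theorem matchingInvolutions_finite (G : SimpleGraph α) {W : Set α} (hW : W.Finite) :
    (matchingInvolutions G W).Finite := by
  classical
  have := hW.to_subtype
  refine Set.Finite.of_injOn (f := fun f (x : W) => if h : f x ∈ W then (⟨f x, h⟩ : W) else x)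
    (t := Set.univ) (fun _ _ => trivial) ?_ Set.finite_univ
  intro f hf g hg h
  funext x
  by_cases hx : x ∈ W
  · have := congrFun h ⟨x, hx⟩
    simpa [(hf.1 x hx).1, (hg.1 x hx).1] using this
  · rw [hf.2 x hx, hg.2 x hx]

/-- Matchings of `W` using the edge `vu` correspond to matchings of `W \ {v, u}` by composition with
the transposition of `v` and `u`. -/
theorem ncard_matchingInvolutions_apply_eq (G : SimpleGraph α) {W : Set α} {u v : α}
    (hv : v ∈ W) (hu : u ∈ W) (huv : G.Adj v u) :
    {f ∈ matchingInvolutions G W | f v = u}.ncard = matchCount G (W \ {v, u}) := by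
  classical
  have hne : v ≠ u := huv.ne
  have key : ∀ g ∈ matchingInvolutions G (W \ {v, u}), g v = v ∧ g u = u := fun g hg =>
    ⟨hg.2 v (by simp), hg.2 u (by simp)⟩
  unfold matchCount
  symm
  refine Set.ncard_congr (fun g _ => g ∘ Equiv.swap v u) ?_ ?_ ?_
  · rintro g hg
    obtain ⟨gv, gu⟩ := key g hg
    refine ⟨⟨?_, ?_⟩, by simp [gu]⟩
    · intro x hx
      by_cases h1 : x = v
      · subst h1; simp [gu, gv, hu, huv]
      by_cases h2 : x = u
      · subst h2; simp [gu, gv, hv, huv.symm]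
      obtain ⟨a, b, c⟩ := hg.1 x ⟨hx, by simp [h1, h2]⟩
      have h3 : g x ≠ v := fun h => a.2 (by simp [h])
      have h4 : g x ≠ u := fun h => a.2 (by simp [h])
      simp [Equiv.swap_apply_of_ne_of_ne h1 h2, Equiv.swap_apply_of_ne_of_ne h3 h4, a.1, b, c]
    · intro x hx
      have h1 : x ≠ v := fun h => hx (h ▸ hv)
      have h2 : x ≠ u := fun h => hx (h ▸ hu)
      simp [Equiv.swap_apply_of_ne_of_ne h1 h2, hg.2 x (fun h => hx h.1)]
  · intro g g' _ _ h
    funext x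
    have := congrFun h (Equiv.swap v u x)
    simpa using this
  · rintro f ⟨hf, fv⟩
    have fu : f u = v := by rw [← fv]; exact (hf.1 v hv).2.2
    refine ⟨f ∘ Equiv.swap v u, ⟨?_, ?_⟩, ?_⟩
    · rintro x ⟨hx, hx'⟩
      have h1 : x ≠ v := fun h => hx' (by simp [h])
      have h2 : x ≠ u := fun h => hx' (by simp [h])
      obtain ⟨a, b, c⟩ := hf.1 x hx
      have h3 : f x ≠ v := fun h => h2 (by rw [← c, h, fv])
      have h4 : f x ≠ u := fun h => h1 (by rw [← c, h, fu])
      simp [Equiv.swap_apply_of_ne_of_ne h1 h2, Equiv.swap_apply_of_ne_of_ne h3 h4, a, b, c, h3, h4]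
    · intro x hx
      by_cases h1 : x = v
      · subst h1; simp [fu]
      by_cases h2 : x = u
      · subst h2; simp [fv]
      have : x ∉ W := fun h => hx ⟨h, by simp [h1, h2]⟩
      simp [Equiv.swap_apply_of_ne_of_ne h1 h2, hf.2 x this]
    · funext x
      simp

open Classical in
/-- Expansion of the number of perfect matchings over the possible partners of a vertex `v`. -/
theorem matchCount_expand (G : SimpleGraph α) {W : Set α} (hW : W.Finite) {v : α} (hv : v ∈ W)
    (F : Finset α) (hF : ∀ y ∈ W, G.Adj v y → y ∈ F) :
    matchCount G W = ∑ u ∈ F, if u ∈ W ∧ G.Adj v u then matchCount G (W \ {v, u}) else 0 := by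
  have h : matchingInvolutions G W = ⋃ u ∈ F.filter (fun u => u ∈ W ∧ G.Adj v u),
      {f ∈ matchingInvolutions G W | f v = u} := by
    ext f
    simp only [Set.mem_iUnion, Finset.mem_filter, exists_prop]
    constructor
    · intro hf
      obtain ⟨a, b, _⟩ := hf.1 v hv
      exact ⟨f v, ⟨hF _ a b, a, b⟩, hf, rfl⟩
    · rintro ⟨_, _, hf, _⟩
      exact hf
  rw [← Finset.sum_filter]
  conv_lhs => rw [matchCount, h]
  have hfin : ∀ u, {f ∈ matchingInvolutions G W | f v = u}.Finite := fun u =>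
    (matchingInvolutions_finite G hW).subset fun f hf => hf.1
  rw [← Finset.set_biUnion_coe, (Finset.finite_toSet _).ncard_biUnion (fun u _ => hfin u),
    finsum_mem_coe_finset]
  · refine Finset.sum_congr rfl fun u hu => ?_
    rw [Finset.mem_filter] at hu
    exact ncard_matchingInvolutions_apply_eq G hv hu.2.1 hu.2.2
  · intro u _ u' _ hne
    rw [Function.onFun, Set.disjoint_left]
    rintro f ⟨_, h1⟩ ⟨_, h2⟩
    exact hne (h1.symm.trans h2)

theorem matchCount_forced (G : SimpleGraph α) {W : Set α} (hW : W.Finite) {v u : α} (hv : v ∈ W)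
    (hu : u ∈ W) (hvu : G.Adj v u) (h : ∀ y ∈ W, G.Adj v y → y = u) :
    matchCount G W = matchCount G (W \ {v, u}) := by
  rw [matchCount_expand G hW hv {u} (by simpa using h)]
  simp [hu, hvu]

theorem matchCount_eq_zero (G : SimpleGraph α) {W : Set α} (hW : W.Finite) {v : α} (hv : v ∈ W)
    (h : ∀ y ∈ W, ¬ G.Adj v y) : matchCount G W = 0 := by
  rw [matchCount_expand G hW hv ∅ (fun y hy hh => (h y hy hh).elim)]
  simp

/-- Vertices `v i` with a single available partner `u i` can be deleted together with these
partners. -/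
theorem matchCount_forced_family {ι : Type*} [DecidableEq ι] (G : SimpleGraph α) {W : Set α}
    (hW : W.Finite)
    (S : Finset ι) (v u : ι → α) (hv : ∀ i ∈ S, v i ∈ W) (hu : ∀ i ∈ S, u i ∈ W)
    (hvi : Function.Injective v) (hui : Function.Injective u) (hd : ∀ i j, v i ≠ u j)
    (hadj : ∀ i ∈ S, G.Adj (v i) (u i)) (h : ∀ i ∈ S, ∀ y ∈ W, G.Adj (v i) y → y = u i) :
    matchCount G W = matchCount G {x ∈ W | ∀ i ∈ S, x ≠ v i ∧ x ≠ u i} := by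
  induction S using Finset.induction_on with
  | empty => simp
  | insert i S hi ih =>
    rw [ih (fun j hj => hv j (by simp [hj])) (fun j hj => hu j (by simp [hj]))
      (fun j hj => hadj j (by simp [hj])) (fun j hj => h j (by simp [hj]))]
    have hne : ∀ j ∈ S, i ≠ j := fun j hj e => hi (e ▸ hj)
    have hv' : v i ∈ {x ∈ W | ∀ j ∈ S, x ≠ v j ∧ x ≠ u j} :=
      ⟨hv i (by simp), fun j hj => ⟨hvi.ne (hne j hj), hd i j⟩⟩
    have hu' : u i ∈ {x ∈ W | ∀ j ∈ S, x ≠ v j ∧ x ≠ u j} :=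
      ⟨hu i (by simp), fun j hj => ⟨(hd j i).symm, hui.ne (hne j hj)⟩⟩
    rw [matchCount_forced G (hW.subset fun x hx => hx.1) hv' hu' (hadj i (by simp))
      (fun y hy => h i (by simp) y hy.1)]
    congr 1
    ext x
    simp only [Set.mem_sdiff, Set.mem_ofPred_eq, Set.mem_insert_iff, Set.mem_singleton_iff,
      Finset.mem_insert, forall_eq_or_imp]
    tauto

end Matchings

/-! ### Exterior products and the top coefficient -/

section Algebra

variable {N : ℕ}

/-- The vector space with basis indexed by the path vertices `0, …, N - 1`. -/
abbrev V (N : ℕ) : Type := Fin N → ℚ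
/-- The exterior algebra of `V N`. -/
abbrev Ext (N : ℕ) : Type := ExteriorAlgebra ℚ (V N)

/-- The `x`-th basis vector of `V N`; it is `0` for `x ≥ N`, which truncates lattice paths and
dominoes that leave the range. -/
def e (N x : ℕ) : V N := fun i => if (i : ℕ) = x then 1 else 0

/-- The exterior product of a list of vectors. -/
def wedge (l : List (V N)) : Ext N := (l.map (ι ℚ)).prod

@[simp] theorem wedge_nil : wedge ([] : List (V N)) = 1 := rfl
@[simp] theorem wedge_cons (v : V N) (l : List (V N)) : wedge (v :: l) = ι ℚ v * wedge l := by
  simp [wedge]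
@[simp] theorem wedge_append (l l' : List (V N)) : wedge (l ++ l') = wedge l * wedge l' := by
  simp [wedge]

theorem ι_mul_ι_comm (v w : V N) : ι ℚ v * ι ℚ w = -(ι ℚ w * ι ℚ v) :=
  eq_neg_of_add_eq_zero_left (ExteriorAlgebra.ι_add_mul_swap v w)

theorem ι_mul_wedge (v : V N) (l : List (V N)) :
    ι ℚ v * wedge l = (-1 : ℚ) ^ l.length • (wedge l * ι ℚ v) := by
  induction l with
  | nil => simp
  | cons w l ih =>
    rw [wedge_cons, ← mul_assoc, ι_mul_ι_comm, neg_mul, mul_assoc, ih]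
    simp [pow_succ, mul_assoc]

theorem wedge_mul_ι (v : V N) (l : List (V N)) :
    wedge l * ι ℚ v = (-1 : ℚ) ^ l.length • (ι ℚ v * wedge l) := by
  rw [ι_mul_wedge, smul_smul, ← mul_pow]
  simp

theorem ι_mul_wedge_of_mem {v : V N} {l : List (V N)} (h : v ∈ l) : ι ℚ v * wedge l = 0 := by
  induction l with
  | nil => simp at h
  | cons w l ih =>
    rw [wedge_cons, ← mul_assoc]
    rcases List.mem_cons.1 h with rfl | h
    · simp
    · rw [ι_mul_ι_comm, neg_mul, mul_assoc, ih h]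
      simp

open Classical in
/-- The coefficient of the volume form `e 0 ∧ … ∧ e (N - 1)`. -/
noncomputable def top (N : ℕ) : Ext N →ₗ[ℚ] ℚ :=
  ExteriorAlgebra.liftAlternating fun i =>
    if h : i = N then h ▸ (Matrix.detRowAlternating : (Fin N → ℚ) [⋀^Fin N]→ₗ[ℚ] ℚ) else 0

theorem top_ιMulti_self (v : Fin N → V N) :
    top N (ExteriorAlgebra.ιMulti ℚ N v) = Matrix.det (Matrix.of v) := by
  simp [top, ExteriorAlgebra.liftAlternating_apply_ιMulti]
  rfl

theorem top_ιMulti_ne {r : ℕ} (h : r ≠ N) (v : Fin r → V N) :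
    top N (ExteriorAlgebra.ιMulti ℚ r v) = 0 := by
  simp [top, ExteriorAlgebra.liftAlternating_apply_ιMulti, h]

theorem wedge_eq_ιMulti (l : List (V N)) : wedge l = ExteriorAlgebra.ιMulti ℚ l.length l.get := by
  rw [ExteriorAlgebra.ιMulti_apply, wedge]
  congr 1
  apply List.ext_get <;> simp

theorem ιMulti_eq_wedge {r : ℕ} (v : Fin r → V N) :
    ExteriorAlgebra.ιMulti ℚ r v = wedge (List.ofFn v) := by
  rw [ExteriorAlgebra.ιMulti_apply, wedge, List.map_ofFn]
  rfl

theorem top_wedge_of_length_ne {l : List (V N)} (h : l.length ≠ N) : top N (wedge l) = 0 := by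
  rw [wedge_eq_ιMulti, top_ιMulti_ne h]

theorem linearMap_ext_wedge {M : Type*} [AddCommGroup M] [Module ℚ M] {f g : Ext N →ₗ[ℚ] M}
    (h : ∀ l, f (wedge l) = g (wedge l)) : f = g := by
  apply ExteriorAlgebra.lhom_ext
  intro r
  ext v
  simpa [ιMulti_eq_wedge] using h (List.ofFn v)

theorem wedge_eq_zero_of_lt {l : List (V N)} (h : N < l.length) : wedge l = 0 := by
  rw [wedge_eq_ιMulti]
  apply AlternatingMap.map_linearDependent
  intro hl
  have := hl.fintype_card_le_finrank
  simp at this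
  omega

/-- The contraction of a product of `r` vectors is a combination of products of `r - 1` vectors,
expressed through linear maps `φ` that vanish on the latter. -/
theorem contractLeft_wedge_length (ξ : Module.Dual ℚ (V N)) (l : List (V N)) (φ : Ext N →ₗ[ℚ] ℚ)
    (hφ : ∀ l' : List (V N), l'.length + 1 = l.length → φ (wedge l') = 0) :
    φ (contractLeft ξ (wedge l)) = 0 := by
  induction l generalizing φ with
  | nil =>
    rw [wedge_nil, contractLeft_one, map_zero]
  | cons v l ih =>
    rw [wedge_cons]
    erw [contractLeft_ι_mul]
    rw [map_sub, map_smul, hφ l rfl]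
    have := ih (φ ∘ₗ LinearMap.mulLeft ℚ (ι ℚ v)) (fun l' h => by
      have := hφ (v :: l') (by simp [h])
      simpa using this)
    simpa using this

/-- Contraction lowers the degree, and there is nothing above the top degree. This vanishing is
the source of all linear relations between dimer counts. -/
theorem top_contractLeft (ξ : Module.Dual ℚ (V N)) (z : Ext N) : top N (contractLeft ξ z) = 0 := by
  have : (top N) ∘ₗ (contractLeft ξ) = 0 := by
    apply linearMap_ext_wedge
    intro l
    by_cases h : l.length = N + 1
    · rw [wedge_eq_zero_of_lt (by omega)]
      simp
    · exact contractLeft_wedge_length ξ l (top N) fun l' hl =>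
        top_wedge_of_length_ne (by omega)
  exact LinearMap.congr_fun this z

/-- The Leibniz rule for contraction, with `ι` of the exterior algebra on both sides. -/
theorem contractLeft_vec_mul (ξ : Module.Dual ℚ (V N)) (v : V N) (z : Ext N) :
    contractLeft ξ (ι ℚ v * z) = ξ v • z - ι ℚ v * contractLeft ξ z :=
  contractLeft_ι_mul ..

theorem contractLeft_wedge_mul {ξ : Module.Dual ℚ (V N)} {l : List (V N)} (h : ∀ v ∈ l, ξ v = 0)
    (z : Ext N) :
    contractLeft ξ (wedge l * z) = (-1 : ℚ) ^ l.length • (wedge l * contractLeft ξ z) := by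
  induction l with
  | nil => simp
  | cons v l ih =>
    rw [wedge_cons, mul_assoc, contractLeft_vec_mul, h v (by simp), ih fun w hw => h w (by simp [hw])]
    simp [pow_succ, mul_assoc]

/-! ### Dominoes and Wick's rule -/

/-- The product of the factors `1 + e x ∧ e (x + 1)` for `a ≤ x < a + l`: the generating function
of sets of disjoint dominoes on the path, that is the exponential of `∑ x, e x ∧ e (x + 1)`. -/
def dominoes (N : ℕ) : ℕ → ℕ → Ext N
  | 0, _ => 1
  | l + 1, a => (1 + ι ℚ (e N a) * ι ℚ (e N (a + 1))) * dominoes N l (a + 1)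

/-- The contraction of `ξ` with the two-form `∑ x, e x ∧ e (x + 1)`, `a ≤ x < a + l`. -/
def dominoVec (N : ℕ) (ξ : Module.Dual ℚ (V N)) (l a : ℕ) : V N :=
  ∑ x ∈ Finset.range l, (ξ (e N (a + x)) • e N (a + x + 1) - ξ (e N (a + x + 1)) • e N (a + x))

theorem ι_mul_pair (v a b : V N) : ι ℚ v * (ι ℚ a * ι ℚ b) = ι ℚ a * ι ℚ b * ι ℚ v := by
  rw [← mul_assoc, ι_mul_ι_comm v a, neg_mul, mul_assoc, ι_mul_ι_comm v b, mul_neg, neg_neg,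
    mul_assoc]

/-- As the domino product is the exponential of a two-form, contracting it with `ξ` multiplies it
by the contraction of the two-form. -/
theorem contractLeft_dominoes (ξ : Module.Dual ℚ (V N)) (l a : ℕ) :
    contractLeft ξ (dominoes N l a) = ι ℚ (dominoVec N ξ l a) * dominoes N l a := by
  induction l generalizing a with
  | zero => simp [dominoes, dominoVec]
  | succ l ih =>
    have h1 : dominoVec N ξ (l + 1) a =
        (ξ (e N a) • e N (a + 1) - ξ (e N (a + 1)) • e N a) + dominoVec N ξ l (a + 1) := by
      rw [dominoVec, Finset.sum_range_succ', add_comm, dominoVec]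
      simp only [add_zero, add_assoc, add_comm 1]
    set p := e N a
    set q := e N (a + 1)
    set y := dominoes N l (a + 1)
    have hy : dominoes N (l + 1) a = y + ι ℚ p * (ι ℚ q * y) := by
      rw [dominoes, add_mul, one_mul, mul_assoc]
    rw [hy, map_add, contractLeft_vec_mul, contractLeft_vec_mul, ih, h1, map_add, map_sub, map_smul,
      map_smul]
    set J := dominoVec N ξ l (a + 1)
    have e1 : ι ℚ p * (ι ℚ p * (ι ℚ q * y)) = 0 := by
      rw [← mul_assoc]; simp
    have e2 : ι ℚ q * (ι ℚ p * (ι ℚ q * y)) = 0 := by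
      rw [← mul_assoc, ι_mul_ι_comm, neg_mul, mul_assoc, ← mul_assoc (ι ℚ q)]; simp
    have e3 : ι ℚ J * (ι ℚ p * (ι ℚ q * y)) = ι ℚ p * (ι ℚ q * (ι ℚ J * y)) := by
      have := ι_mul_pair J p q
      rw [← mul_assoc (ι ℚ p), ← mul_assoc (ι ℚ J), this]
      simp only [mul_assoc]
    simp only [mul_add, mul_sub, sub_mul, add_mul, smul_mul_assoc, mul_smul_comm, e1, e2, e3]
    simp only [smul_zero]
    abel

theorem dominoVec_antisymm (ξ η : Module.Dual ℚ (V N)) (l a : ℕ) :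
    η (dominoVec N ξ l a) = -ξ (dominoVec N η l a) := by
  simp only [dominoVec, map_sum, map_sub, map_smul, smul_eq_mul, ← Finset.sum_neg_distrib]
  exact Finset.sum_congr rfl fun x _ => by ring

/-- The linear form `w ↦ top (w ∧ R ∧ dominoes)` attached to a list `R` of rows. On wedges of basis
vectors it gives, up to sign, dimer counts with the corresponding path vertices removed. -/
noncomputable def dimerForm (N : ℕ) (R : List (V N)) : Ext N →ₗ[ℚ] ℚ :=
  top N ∘ₗ LinearMap.mulRight ℚ (wedge R * dominoes N N 0)

theorem dimerForm_apply (R : List (V N)) (w : Ext N) :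
    dimerForm N R w = top N (w * (wedge R * dominoes N N 0)) := rfl

theorem contractLeft_rows {ξ : Module.Dual ℚ (V N)} {R : List (V N)} (h : ∀ v ∈ R, ξ v = 0) (l a : ℕ) :
    contractLeft ξ (wedge R * dominoes N l a) =
      ι ℚ (dominoVec N ξ l a) * (wedge R * dominoes N l a) := by
  rw [contractLeft_wedge_mul h, contractLeft_dominoes, ← mul_assoc, ← mul_assoc, ι_mul_wedge,
    smul_mul_assoc]

theorem dimerForm_dominoVec {ξ : Module.Dual ℚ (V N)} {R : List (V N)} (h : ∀ v ∈ R, ξ v = 0)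
    (a : V N) :
    dimerForm N R (ι ℚ a * ι ℚ (dominoVec N ξ N 0)) = ξ a * dimerForm N R 1 := by
  have := top_contractLeft ξ (ι ℚ a * (wedge R * dominoes N N 0))
  rw [contractLeft_vec_mul, contractLeft_rows h, map_sub, map_smul, sub_eq_zero] at this
  rw [dimerForm_apply, dimerForm_apply, mul_assoc, ← this, one_mul, smul_eq_mul]

theorem dimerForm_dominoVec₃ {ξ : Module.Dual ℚ (V N)} {R : List (V N)} (h : ∀ v ∈ R, ξ v = 0)
    (a b c : V N) :
    dimerForm N R (ι ℚ a * ι ℚ b * ι ℚ c * ι ℚ (dominoVec N ξ N 0)) =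
      ξ a * dimerForm N R (ι ℚ b * ι ℚ c) - ξ b * dimerForm N R (ι ℚ a * ι ℚ c)
        + ξ c * dimerForm N R (ι ℚ a * ι ℚ b) := by
  have := top_contractLeft ξ (ι ℚ a * (ι ℚ b * (ι ℚ c * (wedge R * dominoes N N 0))))
  simp only [contractLeft_vec_mul, contractLeft_rows h, mul_sub, mul_smul_comm, map_sub, map_smul,
    smul_eq_mul] at this
  simp only [dimerForm_apply, mul_assoc]
  linarith

theorem dimerForm_mul_row {R : List (V N)} (w : Ext N) {x : V N}
    (hx : x ∈ Submodule.span ℚ {v | v ∈ R}) : dimerForm N R (w * ι ℚ x) = 0 := by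
  induction hx using Submodule.span_induction with
  | mem v hv =>
    rw [dimerForm_apply, mul_assoc, ← mul_assoc (ι ℚ v), ι_mul_wedge_of_mem hv]
    simp
  | zero => simp
  | add x y _ _ hx hy => rw [map_add, mul_add, map_add, hx, hy, add_zero]
  | smul c x _ hx => rw [map_smul, mul_smul_comm, map_smul, hx, smul_zero]

/-- Wick's rule for four vectors. The covector `ξ v = dimerForm (v ∧ d)` annihilates the rows, and by
antisymmetry its domino vector pairs with every `η` orthogonal to the rows as `dimerForm 1 • d` does.
Hence the two vectors differ by a combination of rows, which the form does not see, and
`dimerForm_dominoVec₃` for `ξ` is the claim. -/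
theorem dimerForm_wick (R : List (V N)) (a b c d : V N) :
    dimerForm N R 1 * dimerForm N R (ι ℚ a * ι ℚ b * ι ℚ c * ι ℚ d) =
      dimerForm N R (ι ℚ a * ι ℚ d) * dimerForm N R (ι ℚ b * ι ℚ c)
        - dimerForm N R (ι ℚ b * ι ℚ d) * dimerForm N R (ι ℚ a * ι ℚ c)
        + dimerForm N R (ι ℚ c * ι ℚ d) * dimerForm N R (ι ℚ a * ι ℚ b) := by
  let ξ : Module.Dual ℚ (V N) := dimerForm N R ∘ₗ LinearMap.mulRight ℚ (ι ℚ d) ∘ₗ ι ℚ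
  have hξ : ∀ v, ξ v = dimerForm N R (ι ℚ v * ι ℚ d) := fun v => rfl
  have hR : ∀ v ∈ R, ξ v = 0 := fun v hv => by
    rw [hξ, ι_mul_ι_comm, map_neg, dimerForm_mul_row _ (Submodule.subset_span hv), neg_zero]
  have hspan : dominoVec N ξ N 0 - dimerForm N R 1 • d ∈ Submodule.span ℚ {v | v ∈ R} := by
    rw [← Subspace.dualAnnihilator_dualCoannihilator_eq (W := Submodule.span ℚ {v | v ∈ R}),
      Submodule.mem_dualCoannihilator]
    intro η hη
    have hη' : ∀ v ∈ R, η v = 0 := fun v hv =>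
      (Submodule.mem_dualAnnihilator η).1 hη v (Submodule.subset_span hv)
    have := dimerForm_dominoVec hη' d
    rw [map_sub, map_smul, dominoVec_antisymm, hξ, ι_mul_ι_comm, map_neg, this, smul_eq_mul]
    ring
  have h0 := dimerForm_mul_row (ι ℚ a * ι ℚ b * ι ℚ c) hspan
  rw [map_sub, map_smul, mul_sub, map_sub, mul_smul_comm, map_smul, dimerForm_dominoVec₃ hR,
    smul_eq_mul] at h0
  simp only [hξ] at h0
  linarith

/-! ### Path vectors and the shift -/

theorem e_eq_zero {x : ℕ} (h : N ≤ x) : e N x = 0 := by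
  funext i
  have := i.2
  simp [e]
  omega

/-- The generating vector of the endpoints of lattice paths of `m` steps from `x`, each step either
keeping the position or increasing it by one. -/
def pathVec (N : ℕ) : ℕ → ℕ → V N
  | 0, x => e N x
  | m + 1, x => pathVec N m x + pathVec N m (x + 1)

/-- The path vectors of the sources of heights `m + 1, …, 2`. The source of height `h` is the
vertex `(2n + 2 - 2h, 2n + 1)` on the upper side, from which a path takes `h` steps to the
diagonal. -/
def rows (N n : ℕ) : ℕ → List (V N)
  | 0 => []
  | m + 1 => pathVec N (m + 2) (2 * n - 2 * m - 2) :: rows N n m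

theorem dual_pathVec_eq_zero {ξ : Module.Dual ℚ (V N)} {m x : ℕ}
    (h : ∀ y, x ≤ y → y ≤ x + m → ξ (e N y) = 0) : ξ (pathVec N m x) = 0 := by
  induction m generalizing x with
  | zero => exact h x le_rfl le_rfl
  | succ m ih =>
    rw [pathVec, map_add, ih fun y h1 h2 => h y h1 (by omega),
      ih fun y h1 h2 => h y (by omega) (by omega), add_zero]

/-- The embedding `e x ↦ e (x + 1)`. -/
def shift (N : ℕ) : V N →ₗ[ℚ] V (N + 1) where
  toFun v := Fin.cons 0 v
  map_add' v w := by
    funext i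
    refine Fin.cases ?_ (fun i => ?_) i <;> simp
  map_smul' c v := by
    funext i
    refine Fin.cases ?_ (fun i => ?_) i <;> simp

theorem shift_e (x : ℕ) : shift N (e N x) = e (N + 1) (x + 1) := by
  funext i
  refine Fin.cases ?_ (fun i => ?_) i <;> simp [shift, e]

theorem shift_pathVec (m x : ℕ) : shift N (pathVec N m x) = pathVec (N + 1) m (x + 1) := by
  induction m generalizing x with
  | zero => exact shift_e x
  | succ m ih => rw [pathVec, map_add, ih, ih, pathVec]

/-- The algebra map induced by `shift`. -/
noncomputable def shiftExt (N : ℕ) : Ext N →ₐ[ℚ] Ext (N + 1) := ExteriorAlgebra.map (shift N)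

@[simp] theorem shiftExt_ι (v : V N) : shiftExt N (ι ℚ v) = ι ℚ (shift N v) :=
  ExteriorAlgebra.map_apply_ι _ _

theorem shiftExt_wedge (l : List (V N)) : shiftExt N (wedge l) = wedge (l.map (shift N)) := by
  induction l with
  | nil => simp
  | cons v l ih => simp [ih]

theorem shiftExt_dominoes (l a : ℕ) :
    shiftExt N (dominoes N l a) = dominoes (N + 1) l (a + 1) := by
  induction l generalizing a with
  | zero => simp [dominoes]
  | succ l ih => simp [dominoes, ih, shift_e]

theorem top_wedge_ofFn (v : Fin N → V N) : top N (wedge (List.ofFn v)) = (Matrix.of v).det := by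
  rw [← ιMulti_eq_wedge, top_ιMulti_self]

theorem exists_ofFn_eq {l : List (V N)} {r : ℕ} (h : l.length = r) :
    ∃ v : Fin r → V N, List.ofFn v = l := by
  subst h
  exact ⟨l.get, List.ofFn_get l⟩

theorem top_shiftExt (z : Ext N) : top (N + 1) (shiftExt N z) = 0 := by
  have : top (N + 1) ∘ₗ (shiftExt N).toLinearMap = 0 := by
    apply linearMap_ext_wedge
    intro l
    change top (N + 1) (shiftExt N (wedge l)) = 0
    rw [shiftExt_wedge]
    by_cases h : l.length = N + 1
    · obtain ⟨v, rfl⟩ := exists_ofFn_eq h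
      rw [List.map_ofFn, top_wedge_ofFn]
      exact Matrix.det_eq_zero_of_column_eq_zero 0 fun i => by simp [shift]
    · exact top_wedge_of_length_ne (by simpa using h)
  exact LinearMap.congr_fun this z

theorem top_e_zero_mul_shiftExt (z : Ext N) :
    top (N + 1) (ι ℚ (e (N + 1) 0) * shiftExt N z) = top N z := by
  have : top (N + 1) ∘ₗ LinearMap.mulLeft ℚ (ι ℚ (e (N + 1) 0)) ∘ₗ (shiftExt N).toLinearMap
      = top N := by
    apply linearMap_ext_wedge
    intro l
    change top (N + 1) (ι ℚ (e (N + 1) 0) * shiftExt N (wedge l)) = _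
    rw [shiftExt_wedge, ← wedge_cons]
    by_cases h : l.length = N
    · obtain ⟨v, rfl⟩ := exists_ofFn_eq h
      have h2 : e (N + 1) 0 :: (List.ofFn v).map (shift N) =
          List.ofFn (Fin.cons (e (N + 1) 0) (shift N ∘ v) : Fin (N + 1) → V (N + 1)) := by
        rw [List.ofFn_cons, List.map_ofFn]
      have h0 : ∀ i : Fin N, e (N + 1) 0 i.succ = 0 := fun i => by simp [e]
      have h1 : e (N + 1) 0 0 = 1 := by simp [e]
      rw [h2, top_wedge_ofFn, top_wedge_ofFn, Matrix.det_succ_row_zero, Fin.sum_univ_succ]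
      simp only [Fin.val_zero, pow_zero, Matrix.of_apply, Fin.cons_zero, h0, h1, mul_zero, zero_mul,
        Finset.sum_const_zero, add_zero, one_mul]
      congr 1
    · rw [top_wedge_of_length_ne h, top_wedge_of_length_ne (by simpa using h)]
  exact LinearMap.congr_fun this z

theorem mul_pair (z : Ext N) (a b : V N) : z * (ι ℚ a * ι ℚ b) = ι ℚ a * ι ℚ b * z := by
  induction z using ExteriorAlgebra.induction with
  | algebraMap r => exact Algebra.commutes _ _
  | ι v => exact ι_mul_pair v a b
  | mul x y hx hy => rw [mul_assoc, hy, ← mul_assoc, hx, mul_assoc]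
  | add x y hx hy => rw [add_mul, hx, hy, mul_add]

theorem dominoes_succ_zero (N : ℕ) :
    dominoes (N + 1) (N + 1) 0 = shiftExt N (dominoes N N 0)
      + ι ℚ (e (N + 1) 0) * ι ℚ (e (N + 1) 1) * shiftExt N (dominoes N N 0) := by
  rw [dominoes, shiftExt_dominoes, add_mul, one_mul]

/-- The coefficient of the volume form after completion by dominoes. -/
noncomputable def tileTop (N : ℕ) : Ext N →ₗ[ℚ] ℚ :=
  top N ∘ₗ LinearMap.mulRight ℚ (dominoes N N 0)

theorem tileTop_apply (z : Ext N) : tileTop N z = top N (z * dominoes N N 0) := rfl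

theorem tileTop_shiftExt (z : Ext N) :
    tileTop (N + 1) (shiftExt N z) = tileTop N (ι ℚ (e N 0) * z) := by
  rw [tileTop_apply, tileTop_apply, dominoes_succ_zero, mul_add, map_add, ← map_mul, top_shiftExt,
    zero_add, ← mul_assoc, mul_pair, ← top_e_zero_mul_shiftExt (ι ℚ (e N 0) * z * _)]
  simp only [map_mul, shiftExt_ι, shift_e, mul_assoc, zero_add]

theorem tileTop_e_zero_mul_shiftExt (z : Ext N) :
    tileTop (N + 1) (ι ℚ (e (N + 1) 0) * shiftExt N z) = tileTop N z := by
  rw [tileTop_apply, tileTop_apply, dominoes_succ_zero, mul_add, ← mul_assoc _ (_ * _), mul_pair,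
    ← mul_assoc _ (ι ℚ (e (N + 1) 0)), mul_assoc (ι ℚ (e (N + 1) 0)) _ (ι ℚ (e (N + 1) 0)),
    ι_mul_ι_comm (e (N + 1) 1), mul_neg, ← mul_assoc (ι ℚ (e (N + 1) 0)),
    ExteriorAlgebra.ι_sq_zero]
  simp only [zero_mul, neg_zero, add_zero, mul_assoc, ← map_mul, top_e_zero_mul_shiftExt]

/-- If the path vertices `0` and `1` do not occur, they are covered by a domino. -/
theorem tileTop_shiftExt_shiftExt (z : Ext N) :
    tileTop (N + 2) (shiftExt (N + 1) (shiftExt N z)) = tileTop N z := by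
  rw [tileTop_shiftExt, tileTop_e_zero_mul_shiftExt]

/-! ### Domino tilings of a path -/

/-- The sign `∏ k, (-1) ^ (u k - a - k)` of moving the increasing list `u 0, u 1, …` to the front of
`a, a + 1, …`, the dominoes being even. -/
def orderSign : ℕ → List ℕ → ℚ
  | _, [] => 1
  | a, u :: U => (-1) ^ (u + a) * orderSign (a + 1) U

theorem orderSign_succ (a : ℕ) (U : List ℕ) :
    orderSign a U = (-1) ^ U.length * orderSign (a + 1) U := by
  induction U generalizing a with
  | nil => simp [orderSign]
  | cons u U ih =>
    rw [orderSign, orderSign, ih (a + 1), List.length_cons]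
    ring

/-- The exterior product of the basis vectors in a list. -/
def basisWedge (N : ℕ) (U : List ℕ) : Ext N := wedge (U.map (e N))

/-- The product `e 0 ∧ … ∧ e (a - 1)`. -/
def initialWedge (N a : ℕ) : Ext N := basisWedge N (List.range a)

theorem initialWedge_succ (a : ℕ) : initialWedge N (a + 1) = initialWedge N a * ι ℚ (e N a) := by
  simp [initialWedge, basisWedge, List.range_succ]

theorem top_initialWedge : top N (initialWedge N N) = 1 := by
  have h : (List.range N).map (e N) = List.ofFn fun i : Fin N => e N i := by
    rw [List.ofFn_eq_map, ← List.map_coe_finRange_eq_range, List.map_map]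
    rfl
  rw [initialWedge, basisWedge, h, top_wedge_ofFn]
  convert Matrix.det_one (n := Fin N) (R := ℚ) using 2
  ext i j
  simp [e, Matrix.one_apply, Fin.ext_iff, eq_comm]

/-- If `ξ` contracts `z` to zero and `ξ v = 1`, then `z` is the contraction of `v ∧ z`. -/
theorem top_eq_zero_of_contractLeft {ξ : Module.Dual ℚ (V N)} {v : V N} (hv : ξ v = 1) {z : Ext N}
    (hz : contractLeft ξ z = 0) : top N z = 0 := by
  have := top_contractLeft ξ (ι ℚ v * z)
  rwa [contractLeft_vec_mul, hz, hv, mul_zero, sub_zero, one_smul] at this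

/-- The `a`-th coordinate. -/
def coord (N a : ℕ) : Module.Dual ℚ (V N) where
  toFun v := if h : a < N then v ⟨a, h⟩ else 0
  map_add' v w := by split_ifs <;> simp
  map_smul' c v := by split_ifs <;> simp

theorem coord_e_self {a : ℕ} (h : a < N) : coord N a (e N a) = 1 := by simp [coord, e, h]
theorem coord_e_of_ne {a x : ℕ} (h : x ≠ a) : coord N a (e N x) = 0 := by
  simp [coord, e, h.symm]

theorem dominoVec_coord_eq_zero {a b l : ℕ} (h : a < b) : dominoVec N (coord N a) l b = 0 := by
  refine Finset.sum_eq_zero fun x _ => ?_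
  rw [coord_e_of_ne (by omega), coord_e_of_ne (by omega)]
  simp

/-- A product in which `e a` does not occur has no top component. -/
theorem top_no_coord {a l : ℕ} (h : a < N) {L : List ℕ} (hL : a ∉ L) :
    top N (basisWedge N L * dominoes N l (a + 1)) = 0 := by
  refine top_eq_zero_of_contractLeft (coord_e_self h) ?_
  rw [basisWedge, contractLeft_wedge_mul, contractLeft_dominoes, dominoVec_coord_eq_zero (by omega)]
  · simp
  · intro v hv
    obtain ⟨x, hx, rfl⟩ := List.mem_map.1 hv
    exact coord_e_of_ne fun h => hL (h ▸ hx)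

@[simp] theorem basisWedge_nil : basisWedge N [] = 1 := rfl
@[simp] theorem basisWedge_cons (u : ℕ) (U : List ℕ) :
    basisWedge N (u :: U) = ι ℚ (e N u) * basisWedge N U := wedge_cons _ _

theorem ι_mul_basisWedge (v : V N) (U : List ℕ) :
    ι ℚ v * basisWedge N U = (-1 : ℚ) ^ U.length • (basisWedge N U * ι ℚ v) := by
  rw [basisWedge, ι_mul_wedge, List.length_map]

theorem basisWedge_mul_ι (v : V N) (U : List ℕ) :
    basisWedge N U * ι ℚ v = (-1 : ℚ) ^ U.length • (ι ℚ v * basisWedge N U) := by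
  rw [basisWedge, wedge_mul_ι, List.length_map]

theorem ι_mul_basisWedge_of_mem {u : ℕ} {U : List ℕ} (h : u ∈ U) :
    ι ℚ (e N u) * basisWedge N U = 0 :=
  ι_mul_wedge_of_mem (List.mem_map_of_mem h)

theorem ι_mul_mul_dominoes_succ (X : Ext N) (l a : ℕ) :
    ι ℚ (e N a) * (X * dominoes N (l + 1) a) = ι ℚ (e N a) * (X * dominoes N l (a + 1)) := by
  rw [dominoes, add_mul, one_mul, mul_add, mul_add, ← mul_assoc X, mul_pair, mul_assoc, mul_assoc,
    ← mul_assoc (ι ℚ (e N a)) (ι ℚ (e N a)), ExteriorAlgebra.ι_sq_zero, zero_mul, add_zero]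

/-- The signed number of domino tilings of the path vertices from `a` on that are in neither `U`
nor `S`. -/
noncomputable def tiling (N : ℕ) (l a : ℕ) (U S : List ℕ) : ℚ :=
  top N (initialWedge N a * (basisWedge N U * (basisWedge N S * dominoes N l a)))

theorem tiling_cons_left (l a : ℕ) (U S : List ℕ) :
    tiling N (l + 1) a (a :: U) S = tiling N l (a + 1) U S := by
  rw [tiling, tiling, initialWedge_succ, basisWedge_cons, mul_assoc (ι ℚ _),
    ← mul_assoc (basisWedge N U), ι_mul_mul_dominoes_succ]
  simp only [mul_assoc]

theorem tiling_cons_right (l a : ℕ) (U S : List ℕ) :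
    tiling N (l + 1) a U (a :: S) = (-1) ^ U.length * tiling N l (a + 1) U S := by
  rw [tiling, tiling, initialWedge_succ, basisWedge_cons, mul_assoc (ι ℚ _),
    ι_mul_mul_dominoes_succ, ← mul_assoc (basisWedge N U), basisWedge_mul_ι]
  simp only [smul_mul_assoc, mul_smul_comm, map_smul, mul_assoc, smul_eq_mul]

/-- A first vertex in neither list is covered by a domino, so its successor is used as well. -/
theorem tiling_of_notMem {l a : ℕ} {U S : List ℕ} (ha : a < N) (hU : a ∉ U) (hS : a ∉ S) :
    tiling N (l + 1) a U S = (-1) ^ U.length * tiling N l (a + 1) U ((a + 1) :: S) := by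
  have h0 : top N (initialWedge N a * (basisWedge N U * (basisWedge N S *
      dominoes N l (a + 1)))) = 0 := by
    have := top_no_coord (N := N) (l := l) (L := List.range a ++ (U ++ S)) ha (by simp [hU, hS])
    rw [← this]
    simp [basisWedge, initialWedge, mul_assoc]
  rw [tiling, tiling, dominoes, add_mul, one_mul, mul_add, mul_add, mul_add, map_add, h0, zero_add,
    initialWedge_succ, basisWedge_cons]
  rw [← mul_assoc (basisWedge N S), mul_pair, mul_assoc _ (basisWedge N S),
    ← mul_assoc (basisWedge N U), mul_pair]
  rw [mul_assoc (ι ℚ (e N (a + 1))) (basisWedge N S), ← mul_assoc (basisWedge N U),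
    basisWedge_mul_ι]
  simp only [smul_mul_assoc, mul_smul_comm, map_smul, mul_assoc, smul_eq_mul]
  rw [← mul_assoc ((-1 : ℚ) ^ U.length), ← mul_pow]
  simp

theorem tiling_eq_zero {l a : ℕ} {U S : List ℕ} (h : a ∈ U ∨ a ∈ S ∨ N ≤ a) :
    tiling N l a U (a :: S) = 0 := by
  rw [tiling, basisWedge_cons]
  rcases h with h | h | h
  · rw [mul_assoc (ι ℚ _), ← mul_assoc (basisWedge N U), basisWedge_mul_ι,
      ι_mul_basisWedge_of_mem h]
    simp
  · rw [ι_mul_basisWedge_of_mem h]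
    simp
  · simp [e_eq_zero h]

theorem dimerForm_eq_tileTop (R : List (V N)) (w : Ext N) :
    dimerForm N R w = tileTop N (w * wedge R) := by
  rw [dimerForm_apply, tileTop_apply, mul_assoc]

/-! ### The alternating covector -/

/-- The covector `∑ x, (-1) ^ x • (x-th coordinate)`. Since `(1 + t) ^ m` vanishes at `t = -1`, it
annihilates all rows. -/
def altSum (N : ℕ) : Module.Dual ℚ (V N) := ∑ i : Fin N, (-1 : ℚ) ^ (i : ℕ) • LinearMap.proj i

theorem altSum_e {x : ℕ} (h : x < N) : altSum N (e N x) = (-1) ^ x := by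
  rw [altSum, LinearMap.sum_apply, Finset.sum_eq_single (⟨x, h⟩ : Fin N)]
  · simp [e]
  · intro i _ hi
    have : (i : ℕ) ≠ x := fun h' => hi (Fin.ext h')
    simp [e, this]
  · simp

theorem altSum_pathVec {m x : ℕ} (h : x + m + 1 < N) : altSum N (pathVec N (m + 1) x) = 0 := by
  induction m generalizing x with
  | zero =>
    simp only [pathVec, map_add]
    rw [altSum_e (by omega), altSum_e (by omega)]
    ring
  | succ m ih => rw [pathVec, map_add, ih (by omega), ih (by omega), add_zero]

theorem altSum_rows {n m : ℕ} (hN : 2 * n < N) (hm : m ≤ n) : ∀ v ∈ rows N n m, altSum N v = 0 := by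
  induction m with
  | zero => simp [rows]
  | succ m ih =>
    intro v hv
    rcases List.mem_cons.1 hv with rfl | hv
    · exact altSum_pathVec (by omega)
    · exact ih (by omega) v hv

/-- The terms telescope, and only the two ends of the path survive. -/
theorem dominoVec_altSum (hN : 0 < N) :
    dominoVec N (altSum N) N 0 = e N 0 + (-1 : ℚ) ^ N • e N (N - 1) := by
  have key : ∀ k, k < N → ∑ x ∈ Finset.range k, (altSum N (e N (0 + x)) • e N (0 + x + 1)
      - altSum N (e N (0 + x + 1)) • e N (0 + x)) = e N 0 + (-1 : ℚ) ^ (k + 1) • e N k := by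
    intro k hk
    induction k with
    | zero => simp
    | succ k ih =>
      rw [Finset.sum_range_succ, ih (by omega), zero_add, altSum_e (by omega), altSum_e hk]
      simp only [pow_succ]
      module
  obtain ⟨k, rfl⟩ : ∃ k, N = k + 1 := ⟨N - 1, by omega⟩
  rw [dominoVec, Finset.sum_range_succ, key k (by omega), zero_add, e_eq_zero le_rfl]
  simp

theorem dimerForm_altSum {n j : ℕ} (hN : 2 * n < N) (hj : j < N) :
    dimerForm N (rows N n n) (ι ℚ (e N j) * ι ℚ (e N 0))
      + (-1) ^ N * dimerForm N (rows N n n) (ι ℚ (e N j) * ι ℚ (e N (N - 1)))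
      = (-1) ^ j * dimerForm N (rows N n n) 1 := by
  have := dimerForm_dominoVec (altSum_rows hN le_rfl) (e N j)
  rw [altSum_e hj, dominoVec_altSum (by omega)] at this
  rw [← this]
  simp [mul_add]

/-! ### Passing to a smaller size -/

theorem coord_zero_pathVec (hN : 0 < N) (m : ℕ) : coord N 0 (pathVec N m 0) = 1 := by
  induction m with
  | zero => exact coord_e_self hN
  | succ m ih =>
    rw [pathVec, map_add, ih, dual_pathVec_eq_zero (fun y h _ => coord_e_of_ne (by omega)), add_zero]

theorem dominoVec_coord_zero (hN : 0 < N) : dominoVec N (coord N 0) N 0 = e N 1 := by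
  obtain ⟨k, rfl⟩ : ∃ k, N = k + 1 := ⟨N - 1, by omega⟩
  rw [dominoVec, Finset.sum_range_succ', Finset.sum_eq_zero]
  · rw [coord_e_self (by omega), coord_e_of_ne (by omega)]
    simp
  · intro x _
    rw [coord_e_of_ne (by omega), coord_e_of_ne (by omega)]
    simp

theorem rows_succ (N n m : ℕ) (hm : m ≤ n) : rows (N + 2) (n + 1) m =
    ((rows N n m).map (shift N)).map (shift (N + 1)) := by
  induction m with
  | zero => rfl
  | succ m ih =>
    rw [rows, rows, List.map_cons, List.map_cons, ih (by omega), shift_pathVec, shift_pathVec]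
    congr 2
    omega

theorem basisWedge_add_two (U : List ℕ) : basisWedge (N + 2) (U.map (· + 2)) =
    shiftExt (N + 1) (shiftExt N (basisWedge N U)) := by
  rw [basisWedge, basisWedge, shiftExt_wedge, shiftExt_wedge, List.map_map, List.map_map,
    List.map_map]
  congr 2
  funext x
  simp [shift_e]

/-- Removing path vertex `1` passes from size `n + 1` to size `n`: contraction with the coordinate
`0` deletes the first row and produces `e 1`. -/
theorem dimerForm_shift (n : ℕ) (U : List ℕ) :
    dimerForm (N + 2) (rows (N + 2) (n + 1) (n + 1)) (basisWedge (N + 2) (1 :: U.map (· + 2))) =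
      -(-1) ^ U.length * dimerForm N (rows N n n) (basisWedge N U) := by
  set R := rows (N + 2) (n + 1) n with hR
  set p := pathVec (N + 2) (n + 2) (2 * (n + 1) - 2 * n - 2) with hp
  have hp1 : coord (N + 2) 0 p = 1 := by
    rw [hp, show 2 * (n + 1) - 2 * n - 2 = 0 by omega, coord_zero_pathVec (by omega)]
  have hrows : rows (N + 2) (n + 1) (n + 1) = p :: R := rfl
  have hR0 : ∀ v ∈ R, coord (N + 2) 0 v = 0 := by
    rw [hR, rows_succ _ _ _ le_rfl]
    intro v hv
    obtain ⟨w, _, rfl⟩ := List.mem_map.1 hv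
    simp [coord, shift]
  have hU : ∀ v ∈ (U.map (· + 2)).map (e (N + 2)), coord (N + 2) 0 v = 0 := by
    intro v hv
    obtain ⟨w, hw, rfl⟩ := List.mem_map.1 hv
    obtain ⟨x, _, rfl⟩ := List.mem_map.1 hw
    exact coord_e_of_ne (by omega)
  have h1 : dimerForm N (rows N n n) (basisWedge N U) =
      top (N + 2) (basisWedge (N + 2) (U.map (· + 2)) * (wedge R * dominoes (N + 2) (N + 2) 0)) := by
    rw [dimerForm_eq_tileTop, ← tileTop_shiftExt_shiftExt, map_mul, map_mul, ← basisWedge_add_two,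
      shiftExt_wedge, shiftExt_wedge, ← rows_succ _ _ _ le_rfl, tileTop_apply, mul_assoc]
  have h2 := top_contractLeft (coord (N + 2) 0) (basisWedge (N + 2) (U.map (· + 2)) *
    (ι ℚ p * (wedge R * dominoes (N + 2) (N + 2) 0)))
  rw [basisWedge, contractLeft_wedge_mul hU, ← basisWedge, contractLeft_vec_mul, hp1,
    contractLeft_rows hR0, dominoVec_coord_zero (by omega), one_smul, mul_sub, map_smul, map_sub,
    ← h1, smul_eq_mul] at h2
  have h3 : dimerForm N (rows N n n) (basisWedge N U) = top (N + 2)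
      (basisWedge (N + 2) (U.map (· + 2)) * (ι ℚ p * (ι ℚ (e (N + 2) 1) * (wedge R *
        dominoes (N + 2) (N + 2) 0)))) := by
    rcases mul_eq_zero.1 h2 with h | h
    · exact absurd h (by simp)
    · exact sub_eq_zero.1 h
  rw [h3, ← mul_assoc (ι ℚ p), ι_mul_ι_comm, hrows, dimerForm_apply, basisWedge_cons,
    ι_mul_basisWedge]
  simp [mul_assoc]

end Algebra

/-! ### The lattice and the path on its boundary -/

/-- The edge relation of the TSSCPP graphs without the bounds depending on `n`. -/
def latticeEdge (x y : ℕ × ℕ) : Prop :=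
  x.1 ≤ x.2 ∧ ((x.1 + x.2) % 2 = 1 ∧ y.1 = x.1 + 1 ∧ y.2 = x.2 ∨ y.1 = x.1 ∧ y.2 = x.2 + 1 ∨
    x.2 = x.1 ∧ y.1 = x.1 + 1 ∧ y.2 = x.1 + 1)

/-- The infinite graph all of whose induced subgraphs on `vertices n` are the TSSCPP graphs. -/
def lattice : SimpleGraph (ℕ × ℕ) := SimpleGraph.fromRel latticeEdge

theorem lattice_adj {x y : ℕ × ℕ} : lattice.Adj x y ↔ latticeEdge x y ∨ latticeEdge y x := by
  rw [lattice, SimpleGraph.fromRel_adj, and_iff_right_iff_imp]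
  rintro h rfl
  simp [latticeEdge] at h

/-- The vertices `(x, x)` for `x ≤ 2n`, followed by `(2n, 2n + 1)` for `x = 2n + 1`. They form a
path: the last vertex has no neighbour but `(2n, 2n)`. -/
def pathVertex (n x : ℕ) : ℕ × ℕ := (min x (2 * n), x)

theorem pathVertex_inj {n x y : ℕ} : pathVertex n x = pathVertex n y ↔ x = y :=
  ⟨fun h => congrArg Prod.snd h, fun h => h ▸ rfl⟩

theorem lattice_adj_pathVertex {n x y : ℕ} (hx : x ≤ 2 * n + 1) (hy : y ≤ 2 * n + 1) :
    lattice.Adj (pathVertex n x) (pathVertex n y) ↔ y = x + 1 ∨ x = y + 1 := by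
  rw [lattice_adj]
  simp only [latticeEdge, pathVertex]
  omega

/-- The path vertices of index at least `a` and less than `N` outside the lists `U` and `S`. -/
def pathSet (n N a : ℕ) (U S : List ℕ) : Set (ℕ × ℕ) :=
  {v | ∃ x, a ≤ x ∧ x < N ∧ x ∉ U ∧ x ∉ S ∧ v = pathVertex n x}

theorem pathSet_finite (n N a : ℕ) (U S : List ℕ) : (pathSet n N a U S).Finite := by
  refine ((Finset.range N).image (pathVertex n)).finite_toSet.subset ?_
  rintro v ⟨x, _, h, _, _, rfl⟩
  simp only [Finset.coe_image, Set.mem_image]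
  exact ⟨x, by simpa using h, rfl⟩

theorem pathVertex_mem_pathSet {n N a x : ℕ} {U S : List ℕ} :
    pathVertex n x ∈ pathSet n N a U S ↔ a ≤ x ∧ x < N ∧ x ∉ U ∧ x ∉ S := by
  constructor
  · rintro ⟨y, h1, h2, h3, h4, h5⟩
    obtain rfl := pathVertex_inj.1 h5
    exact ⟨h1, h2, h3, h4⟩
  · rintro ⟨h1, h2, h3, h4⟩
    exact ⟨x, h1, h2, h3, h4, rfl⟩

theorem matchCount_pathSet {n N : ℕ} (hN : N ≤ 2 * n + 2) (l a : ℕ) (hl : a + l = N) (U S : List ℕ)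
    (hU : U.Pairwise (· < ·)) (hS : S.Pairwise (· < ·)) (hUa : ∀ u ∈ U, a ≤ u ∧ u < N)
    (hSa : ∀ s ∈ S, a ≤ s ∧ s < N ∧ s ∉ U) :
    (matchCount lattice (pathSet n N a U S) : ℚ) = orderSign a U * tiling N l a U S := by
  induction l generalizing a U S with
  | zero =>
    have h1 : U = [] := List.eq_nil_iff_forall_not_mem.2 fun u hu => by have := hUa u hu; omega
    have h2 : S = [] := List.eq_nil_iff_forall_not_mem.2 fun u hu => by have := hSa u hu; omega
    subst h1 h2
    have h3 : pathSet n N a [] [] = ∅ := by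
      ext v
      simp only [pathSet, Set.mem_ofPred_eq, Set.mem_empty_iff_false, iff_false]
      rintro ⟨x, h1, h2, _⟩
      omega
    have h4 : a = N := by omega
    rw [h3, matchCount_empty, tiling, h4]
    simp [orderSign, dominoes, top_initialWedge]
  | succ l ih =>
    by_cases haU : a ∈ U
    · obtain ⟨u, U, rfl⟩ := List.exists_cons_of_ne_nil (List.ne_nil_of_mem haU)
      obtain ⟨hU1, hU2⟩ := List.pairwise_cons.1 hU
      obtain rfl : a = u := by
        rcases List.mem_cons.1 haU with h | h
        · exact h
        · have := hU1 a h
          have := hUa u (by simp)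
          omega
      have h1 : pathSet n N a (a :: U) S = pathSet n N (a + 1) U S := by
        ext v
        simp only [pathSet, Set.mem_ofPred_eq]
        refine exists_congr fun x => ?_
        have : x ∈ U → a < x := hU1 x
        simp only [List.mem_cons]
        grind
      rw [h1, ih (a + 1) (by omega) U S hU2 hS, tiling_cons_left, orderSign]
      · simp [← two_mul]
      · intro u hu
        have := hU1 u hu
        have := hUa u (by simp [hu])
        omega
      · intro s hs
        have h2 := hSa s hs
        have : s ≠ a := fun h => h2.2.2 (by simp [h])
        exact ⟨by omega, h2.2.1, fun h => h2.2.2 (by simp [h])⟩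
    have hUa' : ∀ u ∈ U, a + 1 ≤ u ∧ u < N := by
      intro u hu
      have := hUa u hu
      have : u ≠ a := fun h => haU (h ▸ hu)
      omega
    by_cases haS : a ∈ S
    · obtain ⟨u, S, rfl⟩ := List.exists_cons_of_ne_nil (List.ne_nil_of_mem haS)
      obtain ⟨hS1, hS2⟩ := List.pairwise_cons.1 hS
      obtain rfl : a = u := by
        rcases List.mem_cons.1 haS with h | h
        · exact h
        · have := hS1 a h
          have := hSa u (by simp)
          omega
      have h1 : pathSet n N a U (a :: S) = pathSet n N (a + 1) U S := by
        ext v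
        simp only [pathSet, Set.mem_ofPred_eq]
        refine exists_congr fun x => ?_
        have : x ∈ S → a < x := hS1 x
        simp only [List.mem_cons]
        grind
      rw [h1, ih (a + 1) (by omega) U S hU hS2 hUa', tiling_cons_right, orderSign_succ a U]
      · have hs : (-1 : ℚ) ^ U.length * (-1) ^ U.length = 1 := by
          rw [← mul_pow]
          simp
        linear_combination (-orderSign (a + 1) U * tiling N l (a + 1) U S) * hs
      · intro s hs
        have h2 := hSa s (by simp [hs])
        have := hS1 s hs
        exact ⟨by omega, h2.2⟩
    have hSa' : ∀ u ∈ S, a + 1 ≤ u := by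
      intro u hu
      have := hSa u hu
      have : u ≠ a := fun h => haS (h ▸ hu)
      omega
    have hv : pathVertex n a ∈ pathSet n N a U S :=
      pathVertex_mem_pathSet.2 ⟨le_rfl, by omega, haU, haS⟩
    have hnb : ∀ y ∈ pathSet n N a U S, lattice.Adj (pathVertex n a) y →
        y = pathVertex n (a + 1) := by
      rintro y ⟨x, h1, h2, _, _, rfl⟩ h
      rw [lattice_adj_pathVertex (by omega) (by omega)] at h
      rw [pathVertex_inj]
      omega
    rw [tiling_of_notMem (by omega) haU haS, ← mul_assoc, mul_comm (orderSign a U), orderSign_succ a U,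
      ← mul_assoc, ← mul_pow]
    by_cases hbad : a + 1 ∈ U ∨ a + 1 ∈ S ∨ N ≤ a + 1
    · rw [tiling_eq_zero hbad, mul_zero, Nat.cast_eq_zero]
      refine matchCount_eq_zero _ (pathSet_finite ..) hv fun y hy hadj => ?_
      rw [hnb y hy hadj, pathVertex_mem_pathSet] at hy
      grind
    · rw [not_or, not_or] at hbad
      rw [matchCount_forced _ (pathSet_finite ..) hv
        (pathVertex_mem_pathSet.2 ⟨by omega, by omega, hbad.1, hbad.2.1⟩)
        ((lattice_adj_pathVertex (by omega) (by omega)).2 (Or.inl rfl)) hnb]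
      have h1 : pathSet n N a U S \ {pathVertex n a, pathVertex n (a + 1)} =
          pathSet n N (a + 1) U ((a + 1) :: S) := by
        ext v
        constructor
        · rintro ⟨⟨x, h1, h2, h3, h4, rfl⟩, h5⟩
          simp only [Set.mem_insert_iff, Set.mem_singleton_iff, pathVertex_inj] at h5
          exact pathVertex_mem_pathSet.2 ⟨by omega, h2, h3, by
            rw [List.mem_cons, not_or]
            exact ⟨by omega, h4⟩⟩
        · rintro ⟨x, h1, h2, h3, h4, rfl⟩
          simp only [List.mem_cons, not_or] at h4
          refine ⟨pathVertex_mem_pathSet.2 ⟨by omega, h2, h3, h4.2⟩, ?_⟩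
          simp only [Set.mem_insert_iff, Set.mem_singleton_iff, pathVertex_inj]
          omega
      rw [h1, ih (a + 1) (by omega) U ((a + 1) :: S) hU ?_ hUa' ?_]
      · norm_num
      · refine List.pairwise_cons.2 ⟨fun s hs => ?_, hS⟩
        have := hSa' s hs
        have : s ≠ a + 1 := fun h => hbad.2.1 (h ▸ hs)
        omega
      · intro s hs
        rcases List.mem_cons.1 hs with rfl | hs
        · exact ⟨le_rfl, by omega, hbad.1⟩
        · exact ⟨hSa' s hs, (hSa s hs).2⟩

/-! ### Matching the triangle layer by layer -/

/-- The triangle `x₁ ≤ x₂ ≤ 2n + 1`, `x₁ ≤ 2n`, with the path vertices of index in `U` or at least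
`N` removed; only `N = 2n + 1` and `N = 2n + 2` are of interest. -/
def region (n N : ℕ) (U : List ℕ) : Set (ℕ × ℕ) :=
  {v | v.1 ≤ v.2 ∧ v.2 ≤ 2 * n + 1 ∧ v.1 ≤ 2 * n ∧
    (v.1 = 2 * n → v.2 = 2 * n + 1 → 2 * n + 1 < N ∧ 2 * n + 1 ∉ U) ∧ (v.1 = v.2 → v.1 ∉ U)}

theorem region_finite (n N : ℕ) (U : List ℕ) : (region n N U).Finite := by
  refine (Set.finite_Iic ((2 * n, 2 * n + 1) : ℕ × ℕ)).subset fun v hv => ?_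
  exact ⟨hv.2.2.1, hv.2.1⟩

/-- The part of `region n N U` still to be matched when the layers `x₂ - x₁ > 2t + 1` are done: the
layer `x₂ - x₁ = 2t + 1` retains the positions in `A`, and the layer below has lost those in `B`.
The vertex `(2n, 2n + 1)` is kept to the end, being a path vertex. -/
def layerState (n N : ℕ) (U : List ℕ) (t : ℕ) (A B : List ℕ) : Set (ℕ × ℕ) :=
  {v ∈ region n N U | (v.2 < v.1 + (2 * t + 1) ∨ (v.1 = 2 * n ∧ v.2 = 2 * n + 1) ∨
    (v.2 = v.1 + (2 * t + 1) ∧ v.1 ∈ A)) ∧ (v.2 = v.1 + 2 * t → v.1 ∉ B)}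

theorem layerState_finite (n N : ℕ) (U : List ℕ) (t : ℕ) (A B : List ℕ) :
    (layerState n N U t A B).Finite :=
  (region_finite n N U).subset fun _ h => h.1

open Classical in
/-- The rightmost remaining vertex of the layer is matched down, to position `a`, or to the right,
to position `a + 1`. -/
theorem matchCount_layerState_cons {n N t a : ℕ} {U A B : List ℕ}
    (ha : a + 2 * t ≤ 2 * n) (ha0 : a < 2 * n) (hA : ∀ x ∈ A, x < a) (hB : ∀ b ∈ B, a < b) :
    matchCount lattice (layerState n N U t (a :: A) B) =
      (if t = 0 ∧ a ∈ U then 0 else matchCount lattice (layerState n N U t A (a :: B))) +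
      (if a + 1 ∈ B ∨ (t = 0 ∧ a + 1 ∈ U) then 0
        else matchCount lattice (layerState n N U t A ((a + 1) :: B))) := by
  have haA : a ∉ A := fun h => (hA a h).false
  have haB : a ∉ B := fun h => (hB a h).false
  have hv : (a, a + 2 * t + 1) ∈ layerState n N U t (a :: A) B := by
    simp only [layerState, region, Set.mem_ofPred_eq, List.mem_cons]
    refine ⟨⟨by omega, by omega, by omega, by omega, by omega⟩, by simp; omega, by omega⟩
  rw [matchCount_expand lattice (layerState_finite ..) hv {(a, a + 2 * t), (a + 1, a + 2 * t + 1)},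
    Finset.sum_pair (by simp)]
  · congr 1
    · have h1 : lattice.Adj (a, a + 2 * t + 1) (a, a + 2 * t) :=
        lattice_adj.2 (Or.inr ⟨by simp, Or.inr (Or.inl ⟨rfl, rfl⟩)⟩)
      have h2 : (a, a + 2 * t) ∈ layerState n N U t (a :: A) B ↔ ¬ (t = 0 ∧ a ∈ U) := by
        simp only [layerState, region, Set.mem_ofPred_eq]
        grind
      have h3 : layerState n N U t (a :: A) B \ {(a, a + 2 * t + 1), (a, a + 2 * t)} =
          layerState n N U t A (a :: B) := by
        ext ⟨x, y⟩
        simp only [layerState, region, Set.mem_ofPred_eq, Set.mem_sdiff, Set.mem_insert_iff,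
          Set.mem_singleton_iff, Prod.mk.injEq, List.mem_cons]
        grind
      simp only [h1, h2, h3, and_true]
      split_ifs <;> tauto
    · have h1 : lattice.Adj (a, a + 2 * t + 1) (a + 1, a + 2 * t + 1) :=
        lattice_adj.2 (Or.inl ⟨by simp; omega, Or.inl ⟨by simp; omega, rfl, rfl⟩⟩)
      have h2 : (a + 1, a + 2 * t + 1) ∈ layerState n N U t (a :: A) B ↔
          ¬ (a + 1 ∈ B ∨ (t = 0 ∧ a + 1 ∈ U)) := by
        simp only [layerState, region, Set.mem_ofPred_eq]
        grind
      have h3 : layerState n N U t (a :: A) B \ {(a, a + 2 * t + 1), (a + 1, a + 2 * t + 1)} =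
          layerState n N U t A ((a + 1) :: B) := by
        ext ⟨x, y⟩
        simp only [layerState, region, Set.mem_ofPred_eq, Set.mem_sdiff, Set.mem_insert_iff,
          Set.mem_singleton_iff, Prod.mk.injEq, List.mem_cons]
        grind
      simp only [h1, h2, h3, and_true]
      split_ifs <;> tauto
  · rintro ⟨x, y⟩ hy hadj
    simp only [lattice_adj, latticeEdge] at hadj
    simp only [layerState, region, Set.mem_ofPred_eq, List.mem_cons] at hy
    simp only [Finset.mem_insert, Finset.mem_singleton, Prod.mk.injEq]
    grind

/-- When the odd layer is exhausted, every vertex left in the layer below is matched down. In the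
next odd layer there remain the positions in `B` and the source at the upper end. -/
theorem matchCount_layerState_nil {n N t : ℕ} {U B : List ℕ} :
    matchCount lattice (layerState n N U (t + 1) [] B) = matchCount lattice
      (layerState n N U t (if t = 0 then B.reverse else (2 * n - 2 * t) :: B.reverse) []) := by
  let S : Finset ℕ := (Finset.range (2 * n - 2 * t)).filter (· ∉ B)
  rw [matchCount_forced_family lattice (layerState_finite ..) S (fun x => (x, x + (2 * t + 2)))
    (fun x => (x, x + (2 * t + 1)))]
  · congr 1
    ext ⟨x, y⟩
    have key : x ∈ (if t = 0 then B.reverse else (2 * n - 2 * t) :: B.reverse) ↔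
        (t ≠ 0 ∧ x = 2 * n - 2 * t) ∨ x ∈ B := by
      split_ifs with h <;> simp [h]
    have hS : (∀ i ∈ S, (x, y) ≠ (i, i + (2 * t + 2)) ∧ (x, y) ≠ (i, i + (2 * t + 1))) ↔
        (y = x + (2 * t + 2) ∨ y = x + (2 * t + 1) → x ∈ B ∨ 2 * n - 2 * t ≤ x) := by
      simp only [S, Finset.mem_filter, Finset.mem_range, ne_eq, Prod.mk.injEq]
      grind
    rw [Set.mem_ofPred_eq, hS]
    simp only [layerState, region, Set.mem_ofPred_eq, key, List.not_mem_nil]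
    grind
  · intro i hi
    simp only [S, Finset.mem_filter, Finset.mem_range] at hi
    simp only [layerState, region, Set.mem_ofPred_eq, List.not_mem_nil]
    grind
  · intro i hi
    simp only [S, Finset.mem_filter, Finset.mem_range] at hi
    simp only [layerState, region, Set.mem_ofPred_eq, List.not_mem_nil]
    grind
  · exact fun x y h => congrArg Prod.fst h
  · exact fun x y h => congrArg Prod.fst h
  · intro i j h
    simp only [Prod.mk.injEq] at h
    omega
  · exact fun i _ => lattice_adj.2 (Or.inr ⟨by simp, Or.inr (Or.inl ⟨rfl, rfl⟩)⟩)
  · rintro i hi ⟨x, y⟩ hy hadj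
    simp only [S, Finset.mem_filter, Finset.mem_range] at hi
    simp only [lattice_adj, latticeEdge] at hadj
    simp only [layerState, region, Set.mem_ofPred_eq, List.not_mem_nil] at hy
    simp only [Prod.mk.injEq]
    grind

theorem layerState_zero_nil {n N : ℕ} {U B : List ℕ} (hN : 2 * n < N) (hN' : N ≤ 2 * n + 2)
    (hB : ∀ b ∈ B, b ≤ 2 * n) : layerState n N U 0 [] B = pathSet n N 0 U B := by
  have hb : 2 * n + 1 ∉ B := fun h => by have := hB _ h; omega
  ext ⟨x, y⟩
  simp only [layerState, region, pathSet, pathVertex, Set.mem_ofPred_eq, Prod.mk.injEq,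
    List.not_mem_nil]
  constructor
  · rintro ⟨⟨h1, h2, h3, h4, h5⟩, h6, h7⟩
    refine ⟨y, ?_⟩
    grind
  · rintro ⟨z, h1, h2, h3, h4, h5, rfl⟩
    by_cases h : y ≤ 2 * n
    · grind
    · obtain rfl : y = 2 * n + 1 := by omega
      grind

theorem layerState_top {n N : ℕ} {U : List ℕ} : layerState n N U (n + 1) [] [] = region n N U := by
  ext ⟨x, y⟩
  simp only [layerState, Set.mem_ofPred_eq, List.not_mem_nil, region]
  grind

/-- The algebraic counterpart of `layerState`: `A` is listed in decreasing and `B` in increasing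
order, so that the product runs over increasing positions. -/
noncomputable def layerValue (n N : ℕ) (U : List ℕ) (t : ℕ) (A B : List ℕ) : ℚ :=
  orderSign 0 U * tileTop N (basisWedge N U * (wedge (A.map (pathVec N (t + 1))).reverse *
    (wedge (B.map (pathVec N t)) * wedge (rows N n (t - 1)))))

theorem layerValue_cons (n N : ℕ) (U : List ℕ) (t a : ℕ) (A B : List ℕ) :
    layerValue n N U t (a :: A) B =
      layerValue n N U t A (a :: B) + layerValue n N U t A ((a + 1) :: B) := by
  simp only [layerValue, List.map_cons, List.reverse_cons, wedge_append, wedge_cons, wedge_nil,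
    mul_one, pathVec, map_add, mul_add, add_mul, mul_assoc]

theorem layerValue_eq_zero_of_mem {n N t b : ℕ} {U A B : List ℕ} (h : b ∈ B) :
    layerValue n N U t A (b :: B) = 0 := by
  rw [layerValue, List.map_cons, wedge_cons, ι_mul_wedge_of_mem (List.mem_map_of_mem h)]
  simp

theorem layerValue_eq_zero_of_mem_left {n N b : ℕ} {U A B : List ℕ} (h : b ∈ U) :
    layerValue n N U 0 A (b :: B) = 0 := by
  rw [layerValue, List.map_cons, wedge_cons, mul_assoc (ι ℚ _), ← mul_assoc (wedge _) (ι ℚ _),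
    wedge_mul_ι, pathVec, smul_mul_assoc, mul_smul_comm, mul_assoc (ι ℚ _), ← mul_assoc (basisWedge N U),
    basisWedge_mul_ι, ι_mul_basisWedge_of_mem h]
  simp

/-- The next source supplies the first vector of the remaining rows; for `t = 0` there is none. -/
theorem layerValue_succ_nil (n N : ℕ) (U : List ℕ) (t : ℕ) (B : List ℕ) :
    layerValue n N U (t + 1) [] B =
      layerValue n N U t (if t = 0 then B.reverse else (2 * n - 2 * t) :: B.reverse) [] := by
  rw [layerValue, layerValue]
  rcases t with _ | t
  · simp [rows]
  · simp [rows, mul_assoc, mul_add, Nat.sub_sub]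

theorem matchCount_layerState_of_nil {n N t : ℕ} {U : List ℕ}
    (h : ∀ B : List ℕ, B.Pairwise (· < ·) → (∀ b ∈ B, b + 2 * t ≤ 2 * n + 1 ∧ b ≤ 2 * n) →
      (t = 0 → ∀ b ∈ B, b ∉ U) →
      (matchCount lattice (layerState n N U t [] B) : ℚ) = layerValue n N U t [] B)
    (A B : List ℕ) (hA : A.Pairwise (· > ·)) (hA' : ∀ a ∈ A, a + 2 * t ≤ 2 * n ∧ a < 2 * n)
    (hB : B.Pairwise (· < ·)) (hB' : ∀ b ∈ B, b + 2 * t ≤ 2 * n + 1 ∧ b ≤ 2 * n)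
    (hBU : t = 0 → ∀ b ∈ B, b ∉ U) (hAB : ∀ a ∈ A, ∀ b ∈ B, a < b) :
    (matchCount lattice (layerState n N U t A B) : ℚ) = layerValue n N U t A B := by
  classical
  induction A generalizing B with
  | nil => exact h B hB hB' hBU
  | cons a A ih =>
    obtain ⟨hA1, hA2⟩ := List.pairwise_cons.1 hA
    have ha := hA' a (by simp)
    rw [matchCount_layerState_cons ha.1 ha.2 hA1 (hAB a (by simp)), layerValue_cons, Nat.cast_add]
    congr 1
    · split_ifs with hc
      · obtain ⟨rfl, hc⟩ := hc
        rw [layerValue_eq_zero_of_mem_left hc, Nat.cast_zero]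
      · refine ih (a :: B) hA2 (fun x hx => hA' x (by simp [hx]))
          (List.pairwise_cons.2 ⟨hAB a (by simp), hB⟩) ?_ ?_ ?_
        · intro b hb
          rcases List.mem_cons.1 hb with rfl | hb
          · omega
          · exact hB' b hb
        · intro ht b hb
          rcases List.mem_cons.1 hb with rfl | hb
          · exact fun h => hc ⟨ht, h⟩
          · exact hBU ht b hb
        · intro x hx b hb
          rcases List.mem_cons.1 hb with rfl | hb
          · exact hA1 x hx
          · exact hAB x (by simp [hx]) b hb
    · split_ifs with hc
      · rcases hc with hc | ⟨rfl, hc⟩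
        · rw [layerValue_eq_zero_of_mem hc, Nat.cast_zero]
        · rw [layerValue_eq_zero_of_mem_left hc, Nat.cast_zero]
      · rw [not_or] at hc
        refine ih ((a + 1) :: B) hA2 (fun x hx => hA' x (by simp [hx]))
          (List.pairwise_cons.2 ⟨fun b hb => ?_, hB⟩) ?_ ?_ ?_
        · have := hAB a (by simp) b hb
          have : b ≠ a + 1 := fun h => hc.1 (h ▸ hb)
          omega
        · intro b hb
          rcases List.mem_cons.1 hb with rfl | hb
          · omega
          · exact hB' b hb
        · intro ht b hb
          rcases List.mem_cons.1 hb with rfl | hb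
          · exact fun h => hc.2 ⟨ht, h⟩
          · exact hBU ht b hb
        · intro x hx b hb
          rcases List.mem_cons.1 hb with rfl | hb
          · have := hA1 x hx
            omega
          · exact hAB x (by simp [hx]) b hb

theorem matchCount_layerState_nil_eq {n N : ℕ} {U : List ℕ} (hN : 2 * n < N) (hN' : N ≤ 2 * n + 2)
    (hU : U.Pairwise (· < ·)) (hUN : ∀ u ∈ U, u < N) (t : ℕ) (ht : t ≤ n + 1)
    (B : List ℕ) (hB : B.Pairwise (· < ·)) (hB' : ∀ b ∈ B, b + 2 * t ≤ 2 * n + 1 ∧ b ≤ 2 * n)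
    (hBU : t = 0 → ∀ b ∈ B, b ∉ U) :
    (matchCount lattice (layerState n N U t [] B) : ℚ) = layerValue n N U t [] B := by
  induction t generalizing B with
  | zero =>
    rw [layerState_zero_nil hN hN' fun b hb => (hB' b hb).2,
      matchCount_pathSet hN' N 0 (zero_add N) U B hU hB (fun u hu => ⟨u.zero_le, hUN u hu⟩)
        (fun b hb => ⟨b.zero_le, by have := hB' b hb; omega, hBU rfl b hb⟩), tiling, layerValue,
      tileTop_apply]
    have hp : pathVec N 0 = e N := rfl
    simp [rows, mul_assoc, initialWedge, hp, basisWedge]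
  | succ t ih =>
    rw [matchCount_layerState_nil, layerValue_succ_nil]
    refine matchCount_layerState_of_nil (ih (by omega)) _ [] ?_ ?_ List.Pairwise.nil (by simp) (by simp)
      (by simp)
    · split_ifs with ht
      · exact List.pairwise_reverse.2 hB
      · refine List.pairwise_cons.2 ⟨fun b hb => ?_, List.pairwise_reverse.2 hB⟩
        have := hB' b (List.mem_reverse.1 hb)
        omega
    · intro a ha
      split_ifs at ha with ht
      · have := hB' a (List.mem_reverse.1 ha)
        omega
      · rcases List.mem_cons.1 ha with rfl | ha
        · omega
        · have := hB' a (List.mem_reverse.1 ha)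
          omega

/-- Dimer counts on the triangle as coefficients in the exterior algebra. -/
theorem matchCount_region {n N : ℕ} {U : List ℕ} (hN : 2 * n < N) (hN' : N ≤ 2 * n + 2)
    (hU : U.Pairwise (· < ·)) (hUN : ∀ u ∈ U, u < N) :
    (matchCount lattice (region n N U) : ℚ) =
      orderSign 0 U * dimerForm N (rows N n n) (basisWedge N U) := by
  rw [← layerState_top, matchCount_layerState_nil_eq hN hN' hU hUN (n + 1) le_rfl [] List.Pairwise.nil
    (by simp) (by simp), layerValue, dimerForm_eq_tileTop]
  simp

/-! ### Relations between dimer counts -/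

theorem orderSign_map_add_two (a : ℕ) (U : List ℕ) :
    orderSign a (U.map (· + 2)) = orderSign a U := by
  induction U generalizing a with
  | nil => rfl
  | cons u U ih =>
    rw [List.map_cons, orderSign, orderSign, ih]
    ring

theorem matchCount_region_shift {n N : ℕ} {U : List ℕ} (hN : 2 * n < N) (hN' : N ≤ 2 * n + 2)
    (hU : U.Pairwise (· < ·)) (hUN : ∀ u ∈ U, u < N) :
    matchCount lattice (region (n + 1) (N + 2) (1 :: U.map (· + 2))) =
      matchCount lattice (region n N U) := by
  have h1 : (1 :: U.map (· + 2)).Pairwise (· < ·) := by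
    refine List.pairwise_cons.2 ⟨?_, ?_⟩
    · intro x hx
      obtain ⟨u, _, rfl⟩ := List.mem_map.1 hx
      omega
    · exact List.pairwise_map.2 (hU.imp fun h => by omega)
  have h2 : ∀ u ∈ 1 :: U.map (· + 2), u < N + 2 := by
    intro x hx
    rcases List.mem_cons.1 hx with rfl | hx
    · omega
    · obtain ⟨u, hu, rfl⟩ := List.mem_map.1 hx
      have := hUN u hu
      omega
  have hs : (-1 : ℚ) ^ U.length * (-1) ^ U.length = 1 := by
    rw [← mul_pow]
    simp
  rw [← Nat.cast_inj (R := ℚ), matchCount_region (by omega) (by omega) h1 h2,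
    matchCount_region hN hN' hU hUN, dimerForm_shift, orderSign, orderSign_map_add_two,
    orderSign_succ 0 U]
  ring

theorem region_append_last {n : ℕ} {U : List ℕ} :
    region n (2 * n + 2) (U ++ [2 * n + 1]) = region n (2 * n + 1) U := by
  ext ⟨x, y⟩
  simp only [region, Set.mem_ofPred_eq, List.mem_append, List.mem_singleton]
  grind

/-- The vertex `(2n, 2n + 1)` must be matched to `(2n, 2n)`. -/
theorem matchCount_region_append {n : ℕ} {U : List ℕ} (h1 : 2 * n ∉ U) (h2 : 2 * n + 1 ∉ U) :
    matchCount lattice (region n (2 * n + 2) U) =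
      matchCount lattice (region n (2 * n + 1) (U ++ [2 * n])) := by
  have hv : (2 * n, 2 * n + 1) ∈ region n (2 * n + 2) U := by
    simp only [region, Set.mem_ofPred_eq]
    grind
  have hu : (2 * n, 2 * n) ∈ region n (2 * n + 2) U := by
    simp only [region, Set.mem_ofPred_eq]
    grind
  rw [matchCount_forced lattice (region_finite ..) hv hu
    (lattice_adj.2 (Or.inr ⟨by simp, Or.inr (Or.inl ⟨rfl, rfl⟩)⟩))]
  · congr 1
    ext ⟨x, y⟩
    simp only [region, Set.mem_ofPred_eq, List.mem_append, List.mem_singleton, Set.mem_sdiff,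
      Set.mem_insert_iff, Prod.mk.injEq, Set.mem_singleton_iff]
    grind
  · rintro ⟨x, y⟩ hy hadj
    simp only [region, Set.mem_ofPred_eq] at hy
    simp only [lattice_adj, latticeEdge] at hadj
    simp only [Prod.mk.injEq]
    omega

/-- The number of path vertices in the graph of size `n`, the last of which is `b n`. -/
def pathLength (n : ℕ) : ℕ := 2 * n + 2 - n % 2

/-- The number of dimer configurations of the graph of size `n` with the path vertices of index in
`U` removed. -/
noncomputable def pathCount (n : ℕ) (U : List ℕ) : ℕ :=
  matchCount lattice (region n (pathLength n) U)

theorem pathCount_eq {n : ℕ} {U : List ℕ} (hU : U.Pairwise (· < ·)) (hUN : ∀ u ∈ U, u < pathLength n) :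
    (pathCount n U : ℚ) = orderSign 0 U *
      dimerForm (pathLength n) (rows (pathLength n) n n) (basisWedge (pathLength n) U) :=
  matchCount_region (by unfold pathLength; omega) (by unfold pathLength; omega) hU hUN

/-- Removing the path vertex `1` and the last one from the graph of size `n + 1` leaves the count for
size `n`. -/
theorem pathCount_succ_last {n : ℕ} {U : List ℕ} (hU : U.Pairwise (· < ·)) (hUN : ∀ u ∈ U, u < 2 * n) :
    pathCount (n + 1) (1 :: U.map (· + 2) ++ [pathLength (n + 1) - 1]) = pathCount n U := by
  have hlt : ∀ u ∈ 1 :: U.map (· + 2), u < 2 * (n + 1) := by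
    intro x hx
    rcases List.mem_cons.1 hx with rfl | hx
    · omega
    · obtain ⟨u, hu, rfl⟩ := List.mem_map.1 hx
      have := hUN u hu
      omega
  have hlt' : ∀ N, 2 * n < N → ∀ u ∈ U, u < N := fun N hN u hu => (hUN u hu).trans hN
  unfold pathCount pathLength
  rcases Nat.mod_two_eq_zero_or_one n with h | h
  · rw [show 2 * (n + 1) + 2 - (n + 1) % 2 = 2 * (n + 1) + 1 by omega,
      show 2 * n + 2 - n % 2 = 2 * n + 2 by omega, Nat.add_sub_cancel, ← matchCount_region_append
        (fun h => (hlt _ h).false) (fun h => absurd (hlt _ h) (by omega)),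
      ← matchCount_region_shift (by omega) le_rfl hU (hlt' _ (by omega))]
    rfl
  · rw [show 2 * (n + 1) + 2 - (n + 1) % 2 = 2 * (n + 1) + 2 by omega,
      show 2 * n + 2 - n % 2 = 2 * n + 1 by omega,
      show 2 * (n + 1) + 2 - 1 = 2 * (n + 1) + 1 by omega, region_append_last,
      ← matchCount_region_shift (by omega) (by omega) hU (hlt' _ (by omega))]
    rfl

/-- Removing the path vertex `1` from the graph of size `n + 1` leaves the count for size `n` without
its last path vertex. -/
theorem pathCount_succ {n : ℕ} {U : List ℕ} (hU : U.Pairwise (· < ·)) (hUN : ∀ u ∈ U, u < 2 * n) :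
    pathCount (n + 1) (1 :: U.map (· + 2)) = pathCount n (U ++ [pathLength n - 1]) := by
  have hlt : ∀ u ∈ 1 :: U.map (· + 2), u < 2 * (n + 1) := by
    intro x hx
    rcases List.mem_cons.1 hx with rfl | hx
    · omega
    · obtain ⟨u, hu, rfl⟩ := List.mem_map.1 hx
      have := hUN u hu
      omega
  have hU' : ∀ m, 2 * n ≤ m → (U ++ [m]).Pairwise (· < ·) := by
    intro m hm
    refine List.pairwise_append.2 ⟨hU, List.pairwise_singleton _ _, fun u hu x hx => ?_⟩
    have := hUN u hu
    obtain rfl := List.mem_singleton.1 hx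
    omega
  have hlt' : ∀ N m, 2 * n < N → m < N → ∀ u ∈ U ++ [m], u < N := by
    intro N m hN hm u hu
    rcases List.mem_append.1 hu with hu | hu
    · exact (hUN u hu).trans hN
    · rwa [List.mem_singleton.1 hu]
  unfold pathCount pathLength
  rcases Nat.mod_two_eq_zero_or_one n with h | h
  · rw [show 2 * (n + 1) + 2 - (n + 1) % 2 = 2 * (n + 1) + 1 by omega,
      show 2 * n + 2 - n % 2 = 2 * n + 2 by omega, show 2 * n + 2 - 1 = 2 * n + 1 by omega,
      ← region_append_last, ← matchCount_region_shift (by omega) le_rfl (hU' _ (by omega))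
        (hlt' _ _ (by omega) (by omega))]
    simp
    rfl
  · rw [show 2 * (n + 1) + 2 - (n + 1) % 2 = 2 * (n + 1) + 2 by omega,
      show 2 * n + 2 - n % 2 = 2 * n + 1 by omega, Nat.add_sub_cancel, matchCount_region_append
        (fun h => (hlt _ h).false) (fun h => absurd (hlt _ h) (by omega)),
      ← matchCount_region_shift (by omega) (by omega) (hU' _ le_rfl)
        (hlt' _ _ (by omega) (by omega))]
    simp
    rfl

theorem pathCount_alternating {n j : ℕ} (hj : j < 2 * n) (hj0 : 0 < j) :
    (pathCount n [0, j] : ℚ) + pathCount n [j, pathLength n - 1] = pathCount n [] := by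
  have hN : 2 * n < pathLength n := by unfold pathLength; omega
  rw [pathCount_eq (by simpa) (by simp; omega), pathCount_eq (by simp; omega) (by simp; omega),
    pathCount_eq (by simp) (by simp)]
  have key := dimerForm_altSum hN (show j < pathLength n by omega)
  rw [ι_mul_ι_comm (e _ j), map_neg] at key
  obtain ⟨k, hk⟩ : ∃ k, pathLength n = k + 1 := ⟨pathLength n - 1, by omega⟩
  simp only [orderSign, basisWedge_cons, basisWedge_nil, mul_one]
  have hs : (-1 : ℚ) ^ j * (-1) ^ j = 1 := by
    rw [← mul_pow]
    simp
  set N := pathLength n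
  have hs2 : (-1 : ℚ) ^ N = - (-1) ^ (N - 1) := by
    rw [hk]; simp [pow_succ]
  set p := dimerForm N (rows N n n) (ι ℚ (e N 0) * ι ℚ (e N j))
  set q := dimerForm N (rows N n n) (ι ℚ (e N j) * ι ℚ (e N (N - 1)))
  set r := dimerForm N (rows N n n) 1
  rw [hs2] at key
  simp only [pow_add, pow_zero, pow_one, one_mul, add_zero]
  linear_combination (-1) ^ j * key + r * hs

/-- Condensation for the path vertices `1 < i < j` and the last one. -/
theorem pathCount_wick {n i j : ℕ} (hi : 1 < i) (hij : i < j) (hj : j < 2 * n) :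
    (pathCount n [] : ℚ) * pathCount n [1, i, j, pathLength n - 1] =
      pathCount n [1, pathLength n - 1] * pathCount n [i, j]
        - pathCount n [i, pathLength n - 1] * pathCount n [1, j]
        + pathCount n [j, pathLength n - 1] * pathCount n [1, i] := by
  have hN : 2 * n < pathLength n := by unfold pathLength; omega
  set N := pathLength n
  set b := N - 1
  have hb : 2 * n ≤ b := by omega
  have hb' : b < N := by omega
  rw [pathCount_eq (by simp) (by simp), pathCount_eq (by simp; omega) (by simp; omega),
    pathCount_eq (by simp; omega) (by simp; omega), pathCount_eq (by simp; omega) (by simp; omega),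
    pathCount_eq (by simp; omega) (by simp; omega), pathCount_eq (by simp; omega) (by simp; omega),
    pathCount_eq (by simp; omega) (by simp; omega), pathCount_eq (by simp; omega) (by simp; omega)]
  simp only [orderSign, basisWedge_cons, basisWedge_nil, mul_one]
  have key := dimerForm_wick (rows N n n) (e N 1) (e N i) (e N j) (e N b)
  simp only [mul_assoc] at key ⊢
  simp only [pow_add]
  linear_combination (-(-1) ^ i * (-1) ^ j * (-1) ^ b) * key

/-- By `pathCount_alternating` with `j = 1`, the count for size `n + 1` is at least the count without
the vertex `1` and the last one, which is the count for size `n`. -/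
theorem pathCount_nil_pos (n : ℕ) : 0 < pathCount n [] := by
  induction n with
  | zero =>
    have h : region 0 1 ([] ++ [2 * 0]) = ∅ := by
      ext ⟨x, y⟩
      simp [region]
      omega
    rw [pathCount, show pathLength 0 = 2 * 0 + 2 from rfl,
      matchCount_region_append List.not_mem_nil List.not_mem_nil, h, matchCount_empty]
    exact one_pos
  | succ n ih =>
    have h1 := pathCount_alternating (n := n + 1) (j := 1) (by omega) one_pos
    have h2 := pathCount_succ_last (n := n) (U := []) List.Pairwise.nil (by simp)
    simp only [List.map_nil, List.cons_append, List.nil_append] at h2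
    rw [h2] at h1
    norm_cast at h1
    omega

/-! ### The counts of the statement -/

theorem edge_iff_latticeEdge {n : ℕ} {x y : ℕ × ℕ} (hx : x ∈ vertices n) (hy : y ∈ vertices n) :
    edge n x y ↔ latticeEdge x y := by
  obtain ⟨x, x'⟩ := x
  obtain ⟨y, y'⟩ := y
  simp only [edge, latticeEdge, vertices, Set.mem_ofPred_eq, Nat.odd_iff, Prod.mk.injEq]
    at hx hy ⊢
  constructor
  · omega
  · rintro ⟨h1, ⟨h2, h3, h4⟩ | ⟨h3, h4⟩ | ⟨h2, h3, h4⟩⟩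
    · exact Or.inl (by omega)
    · exact Or.inr (Or.inl (by omega))
    · exact Or.inr (Or.inr (by omega))

theorem ZDel_eq_pathCount {n : ℕ} {X : Set (ℕ × ℕ)} {U : List ℕ}
    (h : vertices n \ X = region n (pathLength n) U) : ZDel n X = pathCount n U := by
  rw [ZDel, dimerCount_induce, h, pathCount]
  apply matchCount_congr
  intro x hx y hy
  rw [← h] at hx hy
  rw [lattice_adj, graph, SimpleGraph.fromRel_adj, edge_iff_latticeEdge hx.1 hy.1,
    edge_iff_latticeEdge hy.1 hx.1, ← lattice_adj, and_iff_right_iff_imp]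
  exact SimpleGraph.Adj.ne

theorem Z_eq (n : ℕ) : Z n = pathCount n [] := by
  apply ZDel_eq_pathCount
  ext ⟨x, y⟩
  simp only [vertices, region, pathLength, Set.mem_ofPred_eq, Nat.odd_iff, Prod.mk.injEq,
    Set.mem_sdiff, Set.mem_empty_iff_false, List.not_mem_nil]
  grind

theorem ZDel_pair {n i j : ℕ} (hij : i < j) (hj : j < 2 * n) :
    ZDel n {(i, i), (j, j)} = pathCount n [i, j] := by
  apply ZDel_eq_pathCount
  ext ⟨x, y⟩
  simp only [vertices, region, pathLength, Set.mem_ofPred_eq, Nat.odd_iff, Prod.mk.injEq,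
    Set.mem_sdiff, Set.mem_insert_iff, Set.mem_singleton_iff, List.mem_cons, List.not_mem_nil]
  grind

theorem ZDel_b {n j : ℕ} (hj : j < 2 * n) :
    ZDel n {(j, j), b n} = pathCount n [j, pathLength n - 1] := by
  apply ZDel_eq_pathCount
  ext ⟨x, y⟩
  simp only [vertices, region, pathLength, b, Set.mem_ofPred_eq, Nat.odd_iff, Prod.mk.injEq,
    Set.mem_sdiff, Set.mem_insert_iff, Set.mem_singleton_iff, List.mem_cons, List.not_mem_nil]
  grind

end TSSCPP

theorem theorem7p2 (n i j : ℕ) (hij : i < j) (hj : j < 2 * n) :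
    (i = 0 → TSSCPP.g n i j = 1 - TSSCPP.gb n j) ∧
    (i = 1 → TSSCPP.g n i j =
      ((TSSCPP.Z (n - 1) : ℚ) / (TSSCPP.Z n : ℚ)) * TSSCPP.gb (n - 1) (j - 2)) ∧
    (2 ≤ i → TSSCPP.g n i j =
      TSSCPP.g (n - 1) (i - 2) (j - 2)
        - TSSCPP.gb n j * TSSCPP.gb (n - 1) (i - 2)
        + TSSCPP.gb n i * TSSCPP.gb (n - 1) (j - 2)) := by
  open TSSCPP in
  obtain ⟨n, rfl⟩ : ∃ m, n = m + 1 := ⟨n - 1, by omega⟩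
  have hZ : (pathCount (n + 1) [] : ℚ) ≠ 0 := by exact_mod_cast (pathCount_nil_pos (n + 1)).ne'
  have hz : (pathCount n [] : ℚ) ≠ 0 := by exact_mod_cast (pathCount_nil_pos n).ne'
  have hg : g (n + 1) i j = pathCount (n + 1) [i, j] / pathCount (n + 1) [] := by
    rw [g, if_pos hij, ZDel_pair hij hj, Z_eq]
  have hgb : ∀ m k, k < 2 * m → gb m k = pathCount m [k, pathLength m - 1] / pathCount m [] :=
    fun m k hk => by rw [gb, ZDel_b hk, Z_eq]
  rw [Nat.add_sub_cancel]
  refine ⟨?_, ?_, ?_⟩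
  · rintro rfl
    have h := pathCount_alternating hj hij
    rw [hg, hgb _ _ hj]
    field_simp
    linarith
  · rintro rfl
    obtain ⟨j, rfl⟩ : ∃ k, j = k + 2 := ⟨j - 2, by omega⟩
    have h := pathCount_succ (n := n) (U := [j]) (List.pairwise_singleton _ _) (by simp; omega)
    simp only [List.map_cons, List.map_nil, List.cons_append, List.nil_append] at h
    rw [hg, Nat.add_sub_cancel, hgb _ _ (by omega), Z_eq, Z_eq, h]
    field_simp
  · intro hi
    obtain ⟨i, rfl⟩ : ∃ k, i = k + 2 := ⟨i - 2, by omega⟩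
    obtain ⟨j, rfl⟩ : ∃ k, j = k + 2 := ⟨j - 2, by omega⟩
    have hij' : i < j := by omega
    have hj' : j < 2 * n := by omega
    have h1 := pathCount_succ (n := n) (U := [j]) (List.pairwise_singleton _ _) (by simp; omega)
    have h2 := pathCount_succ (n := n) (U := [i]) (List.pairwise_singleton _ _) (by simp; omega)
    have h3 := pathCount_succ_last (n := n) (U := [i, j]) (by simpa) (by simp; omega)
    have h4 := pathCount_succ_last (n := n) (U := []) List.Pairwise.nil (by simp)
    have hw := pathCount_wick (n := n + 1) (show 1 < i + 2 by omega) hij hj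
    simp only [List.map_cons, List.map_nil, List.cons_append, List.nil_append] at h1 h2 h3 h4
    rw [h1, h2, h3, h4] at hw
    have hg' : g n i j = pathCount n [i, j] / pathCount n [] := by
      rw [g, if_pos hij', ZDel_pair hij' hj', Z_eq]
    rw [hg, Nat.add_sub_cancel, Nat.add_sub_cancel, hg', hgb _ _ (by omega), hgb _ _ (by omega),
      hgb _ _ (by omega), hgb _ _ (by omega)]
    field_simp
    linear_combination -hw
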